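/- Let $k$ be a field, and let $\mathscr{C}$ be a $k$-linear $\operatorname{Hom}$-finite triangulated category with split idempotents and ($k$-linear) suspension functor $\Sigma$. For $n \geqslant 1$, an $n$-cluster tilting subcategory of $\mathscr{C}$ is a functorially finite full subcategory $\mathscr{X}$ with $$\mathscr{X} = \{ c \mid \mathscr{C}( x,\Sigma^i c ) = 0 \text{ for } x \in \mathscr{X},\, 1 \leqslant i \leqslant n-1 \} = \{ c \mid \mathscr{C}( c,\Sigma^i x ) = 0 \text{ for } x \in \mathscr{X},\, 1 \leqslant i \leqslant n-1 \}.$$ Let $d$ be an odd positive integer, let $\mathscr{S} \subseteq \mathscr{C}$ be a $d$-cluster tilting subcategory with $\Sigma^d \mathscr{S} = \mathscr{S}$, and let $t \in \mathscr{S}$ be such that $\mathscr{T} = \operatorname{add}( t )$, the full subcategory of direct summands of finite direct sums of copies of $t$, is a $2d$-cluster tilting subcategory of $\mathscr{C}$. Equip $\mathscr{S}$ with its standard $( d+2 )$-angulated structure: a $( d+2 )$-angle in $\mathscr{S}$ is a sequence $s_{d+1} \to s_d \to \cdots \to s_0 \xrightarrow{\gamma} \Sigma^d s_{d+1}$ with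 $s_i \in \mathscr{S}$ for which there are triangles $v_i \to s_i \to v_{i-1} \xrightarrow{\gamma_i} \Sigma v_i$ in $\mathscr{C}$ for $1 \leqslant i \leqslant d$, with $v_d = s_{d+1}$ and $v_0 = s_0$, such that each morphism $s_{i+1} \to s_i$ is the composition of the evident morphisms in these triangles and $\gamma = \Sigma^{d-1}( \gamma_d ) \circ \cdots \circ \Sigma( \gamma_2 ) \circ \gamma_1$. Assume that $\mathscr{S}$ is $2d$-Calabi--Yau, that is, there are $k$-linear isomorphisms $\mathscr{S}( s,s' ) \cong \operatorname{Hom}_k\big( \mathscr{S}( s',( \Sigma^d )^2 s ),k \big)$, natural in $s,s' \in \mathscr{S}$. Let $\operatorname{K}_0^{\operatorname{sp}}( \mathscr{T} )$ be the split Grothendieck group of $\mathscr{T}$. Let $\Gamma = \operatorname{End}_{\mathscr{S}}( t )$, let $\operatorname{mod}( \Gamma )$ be the category of finitely generated right $\Gamma$-modules, with Grothendieck group $\operatorname{K}_0( \operatorname{mod}\,\Gamma )$, and let $F = \mathscr{S}( t,- ) : \mathscr{S} \to \operatorname{mod}( \Gamma )$. Then: (1) For each $s \in \mathscr{S}$ there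 are $( d+2 )$-angles $t_d \xrightarrow{\tau_d} \cdots \xrightarrow{\tau_1} t_0 \to s \to \Sigma^d t_d$ in $\mathscr{S}$ with $t_i \in \mathscr{T}$ and each $\tau_i$ in the radical of $\mathscr{S}$, and the element $\operatorname{index}^{\pentagon}_{\mathscr{T}}( s ) = \sum_{i=0}^d (-1)^i [t_i]$ of $\operatorname{K}_0^{\operatorname{sp}}( \mathscr{T} )$ is the same for all of them. (2) There is a unique homomorphism $\theta : \operatorname{K}_0( \operatorname{mod}\,\Gamma ) \to \operatorname{K}_0^{\operatorname{sp}}( \mathscr{T} )$ of abelian groups such that $\sum_{i=0}^{d+1} (-1)^i \operatorname{index}^{\pentagon}_{\mathscr{T}}( s_i ) = \theta\big( [\operatorname{Im} F\gamma] \big)$ for each $( d+2 )$-angle $s_{d+1} \to \cdots \to s_0 \xrightarrow{\gamma} \Sigma^d s_{d+1}$ in $\mathscr{S}$. (3) Let $\varphi : \operatorname{K}_0^{\operatorname{sp}}( \mathscr{T} ) \to \mathbb{Z}$ be a homomorphism of abelian groups with $\varphi\theta( [M] ) \geqslant 0$ for each $M \in \operatorname{mod}( \Gamma )$. Then $f =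 \varphi \circ \operatorname{index}^{\pentagon}_{\mathscr{T}} : \operatorname{obj}\,\mathscr{S} \to \mathbb{Z}$ is a tropical frieze on $\mathscr{S}$. That is, $f$ is constant on isomorphism classes, $f( s \oplus s' ) = f( s ) + f( s' )$ for $s,s' \in \mathscr{S}$, and $$f( s_0 ) + (-1)^{d+1} f( s_{d+1} ) = \max\Big\{ \sum_{i=1}^d (-1)^{i+1} f( x_i ),\ \sum_{i=1}^d (-1)^{i+1} f( y_i ) \Big\}$$ for all indecomposable $s_0, s_{d+1} \in \mathscr{S}$ with $\dim_k \mathscr{S}( s_0,\Sigma^d s_{d+1} ) = 1$ and all $( d+2 )$-angles $$s_{d+1} \to x_d \to \cdots \to x_1 \to s_0 \xrightarrow{\gamma_0} \Sigma^d s_{d+1}, \qquad s_0 \to y_1 \to \cdots \to y_d \to s_{d+1} \xrightarrow{\gamma_{d+1}} \Sigma^d s_0$$ in $\mathscr{S}$ with $\gamma_0, \gamma_{d+1} \neq 0$. -/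

import Mathlib

open CategoryTheory CategoryTheory.Limits CategoryTheory.Pretriangulated

universe w v u

noncomputable section

namespace HigherFrieze

section Additive

variable {C : Type u} [Category.{v} C] [Preadditive C]

/-- A morphism `f : X ⟶ Y` lies in the radical of the category if `1 - g ∘ f` is invertible
for every `g : Y ⟶ X`. -/
def IsRadical {X Y : C} (f : X ⟶ Y) : Prop :=
  ∀ g : Y ⟶ X, IsIso (𝟙 X - f ≫ g)

/-- `add t`: the direct summands of finite direct sums of copies of `t`. -/
def addClosure [HasFiniteBiproducts C] (t : C) : ObjectProperty C :=
  fun x => ∃ n : ℕ, Nonempty (Retract x (⨁ fun _ : Fin n => t))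

/-- The relations `[a ⊕ b] = [a] + [b]` of the split Grothendieck group of a full subcategory. -/
def splitRelations [HasBinaryBiproducts C] (T : ObjectProperty C) :
    AddSubgroup (FreeAbelianGroup T.FullSubcategory) :=
  AddSubgroup.closure {x | ∃ a b c : T.FullSubcategory, Nonempty (c.obj ≅ a.obj ⊞ b.obj) ∧
    x = FreeAbelianGroup.of c - (FreeAbelianGroup.of a + FreeAbelianGroup.of b)}

/-- The split Grothendieck group `K₀ˢᵖ(T)` of a full subcategory `T` of `C`. -/
abbrev K0Split [HasBinaryBiproducts C] (T : ObjectProperty C) : Type u :=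
  FreeAbelianGroup T.FullSubcategory ⧸ splitRelations T

/-- The class `[x]` of an object `x` of `T` in `K₀ˢᵖ(T)`. -/
def K0Split.cls [HasBinaryBiproducts C] {T : ObjectProperty C} (x : T.FullSubcategory) :
    K0Split T :=
  QuotientAddGroup.mk (FreeAbelianGroup.of x)

end Additive

section Modules

/-- The relations `[M] = [M'] + [M'']` of the Grothendieck group of finitely generated modules,
one for each short exact sequence `0 → M' → M → M'' → 0`. -/
def exactRelations (R : Type v) [Ring R] : AddSubgroup (FreeAbelianGroup (FGModuleCat.{v} R)) :=
  AddSubgroup.closure {x | ∃ (M' M M'' : FGModuleCat.{v} R) (f : M' →ₗ[R] M) (g : M →ₗ[R] M''),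
    Function.Injective f ∧ Function.Exact f g ∧ Function.Surjective g ∧
    x = FreeAbelianGroup.of M - (FreeAbelianGroup.of M' + FreeAbelianGroup.of M'')}

/-- The Grothendieck group of the category of finitely generated left `R`-modules. It is used
for `R = Γᵐᵒᵖ`, where left `R`-modules are right `Γ`-modules. -/
abbrev K0Mod (R : Type v) [Ring R] : Type (v + 1) :=
  FreeAbelianGroup (FGModuleCat.{v} R) ⧸ exactRelations R

/-- The class `[M]` of a finitely generated module `M`. -/
def K0Mod.cls {R : Type v} [Ring R] (M : FGModuleCat.{v} R) : K0Mod R :=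
  QuotientAddGroup.mk (FreeAbelianGroup.of M)

end Modules

section Image

/-- A `Γ`-submodule of `C(t, c)`, regarded as a `k`-subspace. -/
def toSubspace (k : Type w) [Field k] {C : Type u} [Category.{v} C] [Preadditive C]
    [Linear k C] (t c : C) (N : Submodule (End t)ᵐᵒᵖ ((preadditiveCoyonedaObj t).obj c)) :
    Submodule k (t ⟶ c) where
  carrier := {x | x ∈ N}
  add_mem' := fun {_ _} ha hb => N.add_mem ha hb
  zero_mem' := N.zero_mem
  smul_mem' := fun r x hx => by
    have h := N.smul_mem (MulOpposite.op (r • 𝟙 t : End t)) hx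
    have e : (r • 𝟙 t) ≫ x = r • x := by simp
    change r • x ∈ N
    rw [← e]
    exact h

theorem finite_submodule (k : Type w) [Field k] {C : Type u} [Category.{v} C] [Preadditive C]
    [Linear k C] [∀ X Y : C, Module.Finite k (X ⟶ Y)] (t c : C)
    (N : Submodule (End t)ᵐᵒᵖ ((preadditiveCoyonedaObj t).obj c)) :
    Module.Finite (End t)ᵐᵒᵖ N := by
  obtain ⟨s, hs⟩ : (toSubspace k t c N).FG := IsNoetherian.noetherian _
  let s' : Finset ((preadditiveCoyonedaObj t).obj c) := s
  have key : ∀ x : (preadditiveCoyonedaObj t).obj c, x ∈ s' →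
      x ∈ Submodule.span (End t)ᵐᵒᵖ (s' : Set ((preadditiveCoyonedaObj t).obj c)) :=
    fun x hx => Submodule.subset_span hx
  have h : toSubspace k t c N ≤ toSubspace k t c (Submodule.span _ s') := by
    rw [← hs]
    exact Submodule.span_le.mpr key
  refine Module.Finite.iff_fg.mpr ⟨s', le_antisymm ?_ fun x hx => h hx⟩
  refine Submodule.span_le.mpr fun x hx => ?_
  have hx' : x ∈ toSubspace k t c N := hs ▸ Submodule.subset_span hx
  exact hx'

/-- The image of `F γ : F X ⟶ F Y`, where `F = C(t, -)`, as a finitely generated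
right module over `Γ = End t`. -/
def imageF (k : Type w) [Field k] {C : Type u} [Category.{v} C] [Preadditive C] [Linear k C]
    [∀ X Y : C, Module.Finite k (X ⟶ Y)] (t : C) {X Y : C} (γ : X ⟶ Y) : FGModuleCat.{v} (End t)ᵐᵒᵖ :=
  haveI := finite_submodule k t Y (LinearMap.range ((preadditiveCoyonedaObj t).map γ).hom)
  FGModuleCat.of (End t)ᵐᵒᵖ (LinearMap.range ((preadditiveCoyonedaObj t).map γ).hom)

end Image

section Triangulated

variable {C : Type u} [Category.{v} C] [Preadditive C] [HasZeroObject C] [HasShift C ℤ]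
  [∀ n : ℤ, (shiftFunctor C n).Additive] [Pretriangulated C]

/-- `T` is an `n`-cluster tilting subcategory of `C`: it is functorially finite and equals both
`{c | Ext^i(T, c) = 0 for 1 ≤ i ≤ n - 1}` and `{c | Ext^i(c, T) = 0 for 1 ≤ i ≤ n - 1}`,
where `Ext^i(x, y) = C(x, Σ^i y)`. -/
structure IsClusterTilting (n : ℕ) (T : ObjectProperty C) : Prop where
  exists_right_approx : ∀ c : C, ∃ (x : C) (_ : T x) (f : x ⟶ c),
    ∀ y : C, T y → ∀ g : y ⟶ c, ∃ h : y ⟶ x, h ≫ f = g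
  exists_left_approx : ∀ c : C, ∃ (x : C) (_ : T x) (f : c ⟶ x),
    ∀ y : C, T y → ∀ g : c ⟶ y, ∃ h : x ⟶ y, f ≫ h = g
  iff_ext_left : ∀ c : C, T c ↔
    ∀ x : C, T x → ∀ i : ℕ, 1 ≤ i → i < n → ∀ f : x ⟶ c⟦(i : ℤ)⟧, f = 0
  iff_ext_right : ∀ c : C, T c ↔
    ∀ x : C, T x → ∀ i : ℕ, 1 ≤ i → i < n → ∀ f : c ⟶ x⟦(i : ℤ)⟧, f = 0

/-- A `(d+2)`-angle `top ⟶ c (d-1) ⟶ ⋯ ⟶ c 0 ⟶ bot ⟶ Σ^d top` of the standard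
`(d+2)`-angulated structure on a full subcategory `S`: all its objects are in `S`, and it is
given by a tower of triangles `v (i+1) ⟶ c i ⟶ v i ⟶ Σ (v (i+1))`, `0 ≤ i < d`, in the ambient
triangulated category, where `v 0` is `bot` and `v d` is `top`. The morphism `c (i+1) ⟶ c i` is
the composite `c (i+1) ⟶ v (i+1) ⟶ c i`.
The entries `v i` with `i > d` and those of the other families with `i ≥ d` play no role. -/
structure Angle (S : ObjectProperty C) (d : ℕ) (top bot : S.FullSubcategory) where
  c : ℕ → C
  v : ℕ → C
  α (i : ℕ) : v (i + 1) ⟶ c i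
  β (i : ℕ) : c i ⟶ v i
  δ (i : ℕ) : v i ⟶ (v (i + 1))⟦(1 : ℤ)⟧
  distinguished (i : ℕ) : i < d → Triangle.mk (α i) (β i) (δ i) ∈ distTriang C
  mem (i : ℕ) : i < d → S (c i)
  botIso : bot.obj ≅ v 0
  topIso : v d ≅ top.obj

namespace Angle

variable {S : ObjectProperty C} {d : ℕ} {top bot : S.FullSubcategory}

/-- The middle terms of a `(d+2)`-angle, as objects of `S`, counted from the right. -/
def obj (A : Angle S d top bot) (i : Fin d) : S.FullSubcategory :=
  ⟨A.c i, A.mem i i.isLt⟩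

/-- The composite `v 0 ⟶ Σ (v 1) ⟶ ⋯ ⟶ Σ^j (v j)` of the shifted connecting morphisms. -/
def connecting (A : Angle S d top bot) : (j : ℕ) → (A.v 0 ⟶ (A.v j)⟦(j : ℤ)⟧)
  | 0 => (shiftFunctorZero' C ((0 : ℕ) : ℤ) rfl).inv.app (A.v 0)
  | j + 1 => A.connecting j ≫ (A.δ j)⟦(j : ℤ)⟧' ≫
      (shiftFunctorAdd' C (1 : ℤ) (j : ℤ) ((j + 1 : ℕ) : ℤ)
        (by push_cast; exact add_comm _ _)).inv.app (A.v (j + 1))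

/-- The last morphism `bot ⟶ Σ^d top` of a `(d+2)`-angle. -/
def γ (A : Angle S d top bot) : bot.obj ⟶ top.obj⟦(d : ℤ)⟧ :=
  A.botIso.hom ≫ A.connecting d ≫ A.topIso.hom⟦(d : ℤ)⟧'

/-- All morphisms `t_d ⟶ ⋯ ⟶ t_0` between the first `d + 1` objects of a `(d+2)`-angle
`t_d ⟶ ⋯ ⟶ t_0 ⟶ s ⟶ Σ^d t_d` are in the radical. -/
structure Radical (A : Angle S d top bot) : Prop where
  middle : ∀ i : ℕ, i + 1 < d → IsRadical (A.β (i + 1) ≫ A.α i)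
  first : ∀ (i : ℕ) (h : i + 1 = d),
    IsRadical (A.topIso.inv ≫ eqToHom (congrArg A.v h.symm) ≫ A.α i)

end Angle

/-- `x` is the `(d+2)`-angulated index of `s` with respect to `t`: there is a `(d+2)`-angle
`t_d ⟶ ⋯ ⟶ t_0 ⟶ s ⟶ Σ^d t_d` in `S` with all `t_i` in `add t` and all `t_i ⟶ t_{i-1}` radical,
and `x = ∑ (-1)^i [t_i]`. -/
def IsIndex (S : ObjectProperty C) (d : ℕ) (t : C) (s : S.FullSubcategory)
    (x : K0Split (addClosure t)) : Prop :=
  ∃ (top : S.FullSubcategory) (A : Angle S d top s) (htop : addClosure t top.obj)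
    (hmid : ∀ i : Fin d, addClosure t (A.obj i).obj),
    A.Radical ∧
    x = ∑ i : Fin d, (-1 : ℤ) ^ (i : ℕ) • K0Split.cls ⟨(A.obj i).obj, hmid i⟩ +
      (-1 : ℤ) ^ d • K0Split.cls ⟨top.obj, htop⟩

open Classical in
/-- The `(d+2)`-angulated index of `s` with respect to `t`; meaningful where the element `x` with
`IsIndex S d t s x` exists and is unique. -/
def index (S : ObjectProperty C) (d : ℕ) (t : C) (s : S.FullSubcategory) :
    K0Split (addClosure t) :=
  if h : ∃ x, IsIndex S d t s x then h.choose else 0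

section Linear

variable (k : Type w) [Field k] [Linear k C]

/-- `S` is `2d`-Calabi--Yau: there are `k`-linear isomorphisms
`S(X, Y) ≅ D S(Y, (Σ^d)² X)`, natural in `X` and `Y`. -/
def IsCalabiYau (S : ObjectProperty C) (d : ℕ) : Prop :=
  ∃ e : ∀ X Y : S.FullSubcategory,
      (X.obj ⟶ Y.obj) ≃ₗ[k] Module.Dual k (Y.obj ⟶ (X.obj⟦(d : ℤ)⟧)⟦(d : ℤ)⟧),
    (∀ (X Y Y' : S.FullSubcategory) (f : X.obj ⟶ Y.obj) (g : Y.obj ⟶ Y'.obj)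
      (h : Y'.obj ⟶ (X.obj⟦(d : ℤ)⟧)⟦(d : ℤ)⟧), e X Y' (f ≫ g) h = e X Y f (g ≫ h)) ∧
    (∀ (X X' Y : S.FullSubcategory) (a : X'.obj ⟶ X.obj) (f : X.obj ⟶ Y.obj)
      (h : Y.obj ⟶ (X'.obj⟦(d : ℤ)⟧)⟦(d : ℤ)⟧),
      e X' Y (a ≫ f) h = e X Y f (h ≫ (a⟦(d : ℤ)⟧')⟦(d : ℤ)⟧'))

/-- `s₀, s₁` is an exchange pair in `S`: both are indecomposable, and `S(s₀, Σ^d s₁)` is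
one-dimensional over `k`. -/
structure IsExchangePair (S : ObjectProperty C) (d : ℕ) (s₀ s₁ : S.FullSubcategory) : Prop where
  left : Indecomposable s₀.obj
  right : Indecomposable s₁.obj
  finrank_eq_one : Module.finrank k (s₀.obj ⟶ s₁.obj⟦(d : ℤ)⟧) = 1

/-- Tropical friezes on `S`. In the exchange relation, `s₁` is the object usually called
`s_{d+1}`; the angle `A` is `s_{d+1} ⟶ x_d ⟶ ⋯ ⟶ x_1 ⟶ s_0 ⟶ Σ^d s_{d+1}`, so that
`x_{i+1} = A.obj i`; the angle `B` is `s_0 ⟶ y_1 ⟶ ⋯ ⟶ y_d ⟶ s_{d+1} ⟶ Σ^d s_0`, so that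
`y_{i+1} = B.obj i.rev`. -/
structure IsTropicalFrieze (S : ObjectProperty C) (d : ℕ) (f : S.FullSubcategory → ℤ) : Prop where
  iso_invariant : ∀ a b : S.FullSubcategory, Nonempty (a ≅ b) → f a = f b
  additive : ∀ a b c : S.FullSubcategory, Nonempty (c.obj ≅ a.obj ⊞ b.obj) → f c = f a + f b
  exchange : ∀ s₀ s₁ : S.FullSubcategory, IsExchangePair k S d s₀ s₁ →
    ∀ (A : Angle S d s₁ s₀) (B : Angle S d s₀ s₁), A.γ ≠ 0 → B.γ ≠ 0 →
    f s₀ + (-1) ^ (d + 1) * f s₁ =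
      max (∑ i : Fin d, (-1) ^ (i : ℕ) * f (A.obj i))
        (∑ i : Fin d, (-1) ^ (i : ℕ) * f (B.obj i.rev))

variable [∀ X Y : C, Module.Finite k (X ⟶ Y)]

/-- The property that characterises the error term `θ : K₀(mod Γ) → K₀ˢᵖ(add t)`, `Γ = End t`:
for each `(d+2)`-angle `s_{d+1} ⟶ ⋯ ⟶ s_0 ⟶ Σ^d s_{d+1}` in `S` with last morphism `γ`,
`∑ (-1)^i index(s_i) = θ [Im F γ]`. -/
def IsTheta (S : ObjectProperty C) (d : ℕ) (t : C)
    (θ : K0Mod (End t)ᵐᵒᵖ →+ K0Split (addClosure t)) : Prop :=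
  ∀ (top bot : S.FullSubcategory) (A : Angle S d top bot),
    index S d t bot + ∑ i : Fin d, (-1 : ℤ) ^ ((i : ℕ) + 1) • index S d t (A.obj i) +
      (-1 : ℤ) ^ (d + 1) • index S d t top = θ (K0Mod.cls (imageF k t A.γ))

open Classical in
/-- The homomorphism `θ : K₀(mod Γ) → K₀ˢᵖ(add t)`, `Γ = End t`; meaningful where the homomorphism
with the property `IsTheta` exists and is unique. -/
def theta (S : ObjectProperty C) (d : ℕ) (t : C) :
    K0Mod (End t)ᵐᵒᵖ →+ K0Split (addClosure t) :=
  if h : ∃ θ, IsTheta k S d t θ then h.choose else 0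

end Linear

end Triangulated

end HigherFrieze

end

open HigherFrieze

/-! Everything reduces to an index on the triangulated category itself. Write `F` for `C(t, -)`.
Since `add t` is cluster tilting, there is a map `ind` from objects of `C` to the split Grothendieck
group which extends `x ↦ [x]` and is additive on every triangle whose connecting morphism is killed
by `F`. It is obtained by resolving objects by approximations from `add t`
(`exists_isIndexOn_pred`). In an angle that computes the index of `s`, all connecting morphisms are
killed, so the alternating sum telescopes to `ind s` (`IsIndex.eq`).

For an arbitrary triangle `a ⟶ b ⟶ c` with connecting morphism `γ`, the defect `ind a - ind b + ind
c` depends only on the module `Im F γ`. It equals `ind n + ind n[1]` for any `n` such that `n[1]` is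
the cone of a morphism in `add t` and `F(n[1]) ≅ Im F γ` (`exists_presented`, `indexSum_eq`). This
expression is additive on short exact sequences (`thetaObj_exact`), which gives `θ`. In the tower of
an angle only the first triangle has a defect, and its module is the image of `F` on the last
morphism of the angle (`sum_index`).

For uniqueness, Calabi–Yau duality realises each simple `Γ`-module as an image `Im F γ`
(`exists_range_equiv_of_simple`). Every such `γ` sits in an angle (`exists_angle`), and simple
modules generate the Grothendieck group of the artinian ring `Γ`.

For the frieze, `φθ ≥ 0` makes each exchange sum at most the left hand side. Calabi–Yau duality and
one-dimensionality force one of the two exchange morphisms to be killed by `F`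
(`killedBy_or_killedBy`), and its sum attains equality. -/

namespace HigherFrieze

/-! ### Objects of `add t` and morphisms killed by `C(t, -)`. -/

section AddClosure

variable {C : Type u} [Category.{v} C] [Preadditive C]

/-- The functor `C(t, -)` kills the morphism `f`. -/
def KilledBy (t : C) {X Y : C} (f : X ⟶ Y) : Prop := ∀ g : t ⟶ X, g ≫ f = 0

lemma KilledBy.comp_left {t X Y Z : C} {f : Y ⟶ Z} (hf : KilledBy t f) (g : X ⟶ Y) :
    KilledBy t (g ≫ f) := fun h => by
  rw [← Category.assoc]
  exact hf _

variable [HasFiniteBiproducts C]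

lemma addClosure_self (t : C) : addClosure t t :=
  ⟨1, ⟨{ i := biproduct.ι (fun _ : Fin 1 => t) 0
         r := biproduct.π (fun _ : Fin 1 => t) 0
         retract := by simp }⟩⟩

lemma addClosure_biproduct (t : C) (n : ℕ) : addClosure t (⨁ fun _ : Fin n => t) :=
  ⟨n, ⟨Retract.refl _⟩⟩

lemma addClosure_of_retract {t x y : C} (hx : addClosure t x) (r : Retract y x) :
    addClosure t y := by
  obtain ⟨n, ⟨h⟩⟩ := hx
  exact ⟨n, ⟨r.trans h⟩⟩

/-- The identity of an object of `add t` is a sum of endomorphisms which factor through `t`. -/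
lemma addClosure.exists_sum {t x : C} (hx : addClosure t x) :
    ∃ (n : ℕ) (p : Fin n → (x ⟶ t)) (q : Fin n → (t ⟶ x)), ∑ j, p j ≫ q j = 𝟙 x := by
  obtain ⟨n, ⟨r⟩⟩ := hx
  refine ⟨n, fun j => r.i ≫ biproduct.π _ j, fun j => biproduct.ι (fun _ : Fin n => t) j ≫ r.r, ?_⟩
  have h : ∑ j : Fin n, (r.i ≫ biproduct.π (fun _ : Fin n => t) j) ≫
      biproduct.ι (fun _ : Fin n => t) j ≫ r.r =
      r.i ≫ (∑ j : Fin n, biproduct.π (fun _ : Fin n => t) j ≫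
        biproduct.ι (fun _ : Fin n => t) j) ≫ r.r := by
    simp only [Preadditive.sum_comp, Preadditive.comp_sum, Category.assoc]
  rw [h, biproduct.total]
  simp

lemma KilledBy.of_addClosure {t x X Y : C} {f : X ⟶ Y} (hf : KilledBy t f)
    (hx : addClosure t x) : KilledBy x f := fun g => by
  obtain ⟨n, p, q, h⟩ := hx.exists_sum
  rw [← Category.id_comp (g ≫ f), ← h, Preadditive.sum_comp]
  refine Finset.sum_eq_zero fun j _ => ?_
  have := hf (q j ≫ g)
  simp only [Category.assoc] at this ⊢
  rw [this, comp_zero]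

/-- A right `add t`-approximation. -/
def IsApprox (t : C) {x c : C} (f : x ⟶ c) : Prop := ∀ g : t ⟶ c, ∃ h : t ⟶ x, h ≫ f = g

end AddClosure

/-! ### Homotopy pullbacks and vanishing of extensions along triangles. -/

section Triangles

variable {C : Type u} [Category.{v} C] [Preadditive C] [HasZeroObject C] [HasShift C ℤ]
  [∀ n : ℤ, (shiftFunctor C n).Additive] [Pretriangulated C]

/-- The homotopy pullback of two morphisms `g : x ⟶ c` and `f : y ⟶ c`. -/
lemma exists_homotopyPullback [IsTriangulated C] {v x c y w : C} {i : v ⟶ x} {g : x ⟶ c}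
    {δ : c ⟶ v⟦(1 : ℤ)⟧} (h : Triangle.mk i g δ ∈ distTriang C) {j : w ⟶ y} {f : y ⟶ c}
    {ε : c ⟶ w⟦(1 : ℤ)⟧} (h' : Triangle.mk j f ε ∈ distTriang C) :
    ∃ (p : C) (a : v ⟶ p) (b : p ⟶ y) (a' : w ⟶ p) (b' : p ⟶ x),
      Triangle.mk a b (f ≫ δ) ∈ distTriang C ∧ Triangle.mk a' b' (g ≫ ε) ∈ distTriang C ∧
      b' ≫ g = b ≫ f := by
  obtain ⟨p, a, b, hp⟩ := distinguished_cocone_triangle₂ (f ≫ δ)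
  obtain ⟨o⟩ : Nonempty (Triangulated.Octahedron' (rfl : f ≫ δ = f ≫ δ) h'
      (rot_of_distTriang _ h) (rot_of_distTriang _ hp)) :=
    ⟨Triangulated.someOctahedron' _ _ _ _⟩
  exact ⟨p, a, b, o.m₁, o.m₃, hp, o.mem, o.comm₄⟩

/-- `C(t, Σ^i c) = 0`. -/
def Orth (t c : C) (i : ℤ) : Prop := ∀ f : t ⟶ c⟦i⟧, f = 0

omit [HasZeroObject C] [∀ n : ℤ, (shiftFunctor C n).Additive] [Pretriangulated C] in
lemma orth_shift_iff {t c : C} {i j n : ℤ} (h : i + j = n) :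
    (∀ f : t ⟶ (c⟦i⟧)⟦j⟧, f = 0) ↔ Orth t c n := by
  constructor
  · intro H f
    have := H (f ≫ (shiftFunctorAdd' C i j n h).hom.app c)
    rw [← cancel_mono ((shiftFunctorAdd' C i j n h).hom.app c), this, zero_comp]
  · intro H f
    have := H (f ≫ (shiftFunctorAdd' C i j n h).inv.app c)
    rw [← cancel_mono ((shiftFunctorAdd' C i j n h).inv.app c), this, zero_comp]

lemma Orth.of_addClosure {t c x : C} {i : ℤ} (h : Orth t c i) (hx : addClosure t x) :
    Orth x c i := fun f => by
  have : KilledBy t (𝟙 (c⟦i⟧)) := fun g => by rw [h g, zero_comp]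
  simpa using this.of_addClosure hx f

omit [Pretriangulated C] in
lemma Orth.of_iso {t c c' : C} {i : ℤ} (h : Orth t c i) (e : c ≅ c') : Orth t c' i := fun f => by
  have := h (f ≫ e.inv⟦i⟧')
  rw [← cancel_mono (e.inv⟦i⟧'), this, zero_comp]

variable {t a b c : C} {f : a ⟶ b} {g : b ⟶ c} {δ : c ⟶ a⟦(1 : ℤ)⟧}
  (h : Triangle.mk f g δ ∈ distTriang C)

include h

lemma orth₁ {i j : ℤ} (hij : i + 1 = j) (hb : Orth t b j) (hc : Orth t c i) : Orth t a j := by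
  rw [← orth_shift_iff hij]
  intro φ
  obtain ⟨ψ, hψ⟩ := Triangle.coyoneda_exact₁ _ (Triangle.shift_distinguished _ h i) φ
    ((orth_shift_iff hij).2 hb _)
  rw [hψ, hc ψ]
  exact zero_comp

lemma orth₂ {i : ℤ} (ha : Orth t a i) (hc : Orth t c i) : Orth t b i := by
  intro φ
  obtain ⟨ψ, hψ⟩ := Triangle.coyoneda_exact₂ _ (Triangle.shift_distinguished _ h i) φ (hc _)
  rw [hψ, ha ψ]
  exact zero_comp

lemma orth₃ {i j : ℤ} (hij : i + 1 = j) (ha : Orth t a j) (hb : Orth t b i) : Orth t c i := by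
  intro φ
  obtain ⟨ψ, hψ⟩ := Triangle.coyoneda_exact₃ _ (Triangle.shift_distinguished _ h i) φ
    ((orth_shift_iff hij).2 ha _)
  rw [hψ, hb ψ]
  exact zero_comp

lemma isApprox_iff_killedBy : IsApprox t g ↔ KilledBy t δ := by
  constructor
  · intro H φ
    obtain ⟨ψ, rfl⟩ := H φ
    have : g ≫ δ = 0 := comp_distTriang_mor_zero₂₃ _ h
    rw [Category.assoc, this, comp_zero]
  · intro H φ
    obtain ⟨ψ, hψ⟩ := Triangle.coyoneda_exact₃ _ h φ (H φ)
    exact ⟨ψ, hψ.symm⟩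

/-- The syzygy of an approximation has no extensions with `t`. -/
lemma IsApprox.orth_one (hg : IsApprox t g) (hb : Orth t b 1) : Orth t a 1 := fun φ => by
  obtain ⟨ψ, hψ⟩ := Triangle.coyoneda_exact₁ _ h φ (hb _)
  rw [hψ]
  exact (isApprox_iff_killedBy h).1 hg ψ

lemma exists_iso_biprod (hδ : δ = 0) : Nonempty (b ≅ a ⊞ c) := by
  obtain ⟨e, -⟩ := exists_iso_binaryBiproduct_of_distTriang _ h hδ
  exact ⟨e⟩

end Triangles

section CoconesAndSums

variable {C : Type u} [Category.{v} C] [Preadditive C] [HasZeroObject C] [HasShift C ℤ]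
  [∀ n : ℤ, (shiftFunctor C n).Additive] [Pretriangulated C]

/-- The cocone of a composite is an extension of the cocones. -/
lemma exists_cocone_comp [IsTriangulated C] {v x y w z : C} {i : v ⟶ x} {f : x ⟶ y}
    {δ : y ⟶ v⟦(1 : ℤ)⟧} (h : Triangle.mk i f δ ∈ distTriang C) {j : w ⟶ y} {g : y ⟶ z}
    {ε : z ⟶ w⟦(1 : ℤ)⟧} (h' : Triangle.mk j g ε ∈ distTriang C) :
    ∃ (p : C) (k : p ⟶ x) (η : z ⟶ p⟦(1 : ℤ)⟧) (a : v ⟶ p) (b : p ⟶ w),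
      Triangle.mk k (f ≫ g) η ∈ distTriang C ∧ Triangle.mk a b (j ≫ δ) ∈ distTriang C ∧
      η ≫ b⟦(1 : ℤ)⟧' = ε := by
  obtain ⟨p, k, η, hp⟩ := distinguished_cocone_triangle₁ (f ≫ g)
  let o := Triangulated.someOctahedron' (rfl : f ≫ g = f ≫ g) h h' hp
  exact ⟨p, k, η, o.m₁, o.m₃, hp, o.mem, o.comm₃⟩

/-- The triangle of a direct sum decomposition. -/
lemma distinguished_of_iso_biprod {a b c : C} (e : b ≅ a ⊞ c) :
    Triangle.mk (biprod.inl ≫ e.inv) (e.hom ≫ biprod.snd) (0 : c ⟶ a⟦(1 : ℤ)⟧) ∈ distTriang C := by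
  refine isomorphic_distinguished _ (binaryBiproductTriangle_distinguished a c) _ ?_
  exact Triangle.isoMk _ _ (Iso.refl _) e (Iso.refl _)
    (by change (biprod.inl ≫ e.inv) ≫ e.hom = 𝟙 _ ≫ biprod.inl; simp)
    (by change (e.hom ≫ biprod.snd) ≫ 𝟙 _ = e.hom ≫ biprod.snd; simp)
    (zero_comp.trans comp_zero.symm)

end CoconesAndSums

/-! ### Closure properties of cluster tilting subcategories. -/

section ClusterTilting

variable {C : Type u} [Category.{v} C] [Preadditive C] [HasZeroObject C] [HasShift C ℤ]
  [∀ n : ℤ, (shiftFunctor C n).Additive] [Pretriangulated C]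

namespace IsClusterTilting

variable {n : ℕ} {T : ObjectProperty C} (hT : IsClusterTilting n T)
include hT

omit [HasZeroObject C] [∀ n : ℤ, (shiftFunctor C n).Additive] [Pretriangulated C] in
lemma orth {x y : C} (hx : T x) (hy : T y) {i : ℤ} (h1 : 1 ≤ i) (h2 : i < n) : Orth x y i := by
  obtain ⟨j, rfl⟩ : ∃ j : ℕ, i = j := ⟨i.toNat, by omega⟩
  exact (hT.iff_ext_left y).1 hy x hx j (by omega) (by omega)

lemma biprod {x y : C} (hx : T x) (hy : T y) : T (x ⊞ y) :=
  (hT.iff_ext_right _).2 fun z hz i h1 h2 f => by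
    apply biprod.hom_ext'
    · rw [comp_zero]; exact (hT.iff_ext_right x).1 hx z hz i h1 h2 _
    · rw [comp_zero]; exact (hT.iff_ext_right y).1 hy z hz i h1 h2 _

omit [HasZeroObject C] [∀ n : ℤ, (shiftFunctor C n).Additive] [Pretriangulated C] in
lemma of_isZero {x : C} (hx : IsZero x) : T x :=
  (hT.iff_ext_right _).2 fun _ _ _ _ _ _ => hx.eq_of_src _ _

omit [HasZeroObject C] [∀ n : ℤ, (shiftFunctor C n).Additive] [Pretriangulated C] in
lemma of_retract {x y : C} (hx : T x) (r : Retract y x) : T y :=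
  (hT.iff_ext_right _).2 fun z hz i h1 h2 f => by
    rw [← Category.id_comp f, ← r.retract, Category.assoc,
      (hT.iff_ext_right x).1 hx z hz i h1 h2 (r.r ≫ f), comp_zero]

omit [HasZeroObject C] [∀ n : ℤ, (shiftFunctor C n).Additive] [Pretriangulated C] in
lemma of_iso {x y : C} (hx : T x) (e : x ≅ y) : T y := hT.of_retract hx ⟨e.inv, e.hom, by simp⟩

lemma of_addClosure {t x : C} (ht : T t) (hx : addClosure t x) : T x :=
  (hT.iff_ext_right _).2 fun z hz i h1 h2 => by
    have : Orth t z (i : ℤ) := (hT.iff_ext_right t).1 ht z hz i h1 h2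
    exact this.of_addClosure hx

lemma mem_of_orth {t : C} (hTt : T = addClosure t) {c : C}
    (h : ∀ i : ℤ, 1 ≤ i → i < n → Orth t c i) : T c :=
  (hT.iff_ext_left _).2 fun x hx i h1 h2 =>
    (h i (by omega) (by omega)).of_addClosure (hTt ▸ hx)

end IsClusterTilting

lemma IsClusterTilting.exists_approx {n : ℕ} {t : C} (hT : IsClusterTilting n (addClosure t))
    (c : C) : ∃ (v x : C) (i : v ⟶ x) (f : x ⟶ c) (δ : c ⟶ v⟦(1 : ℤ)⟧),
      Triangle.mk i f δ ∈ distTriang C ∧ addClosure t x ∧ IsApprox t f := by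
  obtain ⟨x, hx, f, hf⟩ := hT.exists_right_approx c
  obtain ⟨v, i, δ, h⟩ := distinguished_cocone_triangle₁ f
  exact ⟨v, x, i, f, δ, h, hx, hf t (addClosure_self t)⟩

end ClusterTilting


/-! ### Construction of the triangulated index. -/

section Index

open scoped ZeroObject

variable {C : Type u} [Category.{v} C] [Preadditive C] [HasZeroObject C] [HasShift C ℤ]
  [∀ n : ℤ, (shiftFunctor C n).Additive] [Pretriangulated C]

lemma K0Split.cls_eq_add {T : ObjectProperty C} {a b c : T.FullSubcategory}
    (e : Nonempty (c.obj ≅ a.obj ⊞ b.obj)) : K0Split.cls c = K0Split.cls a + K0Split.cls b := by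
  have h : FreeAbelianGroup.of c - (FreeAbelianGroup.of a + FreeAbelianGroup.of b) ∈
      splitRelations T := AddSubgroup.subset_closure ⟨a, b, c, e, rfl⟩
  rw [← QuotientAddGroup.eq_zero_iff, QuotientAddGroup.mk_sub, QuotientAddGroup.mk_add,
    sub_eq_zero] at h
  exact h

/-- An additive extension of `x ↦ [x]` to the objects without extensions with `t` in degrees
`1, …, m`: it is additive on those triangles whose last morphism is killed by `C(t, -)`. -/
structure IsIndexOn (t : C) (m : ℤ) (ind : C → K0Split (addClosure t)) : Prop where
  cls : ∀ (x : C) (hx : addClosure t x), ind x = K0Split.cls ⟨x, hx⟩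
  add : ∀ {a b c : C} {f : a ⟶ b} {g : b ⟶ c} {δ : c ⟶ a⟦(1 : ℤ)⟧},
    Triangle.mk f g δ ∈ distTriang C → KilledBy t δ →
    (∀ i, 1 ≤ i → i ≤ m → Orth t a i) → (∀ i, 1 ≤ i → i ≤ m → Orth t b i) →
    (∀ i, 1 ≤ i → i ≤ m → Orth t c i) → ind b = ind a + ind c

variable {t : C} {n : ℕ} (hT : IsClusterTilting n (addClosure t))
include hT

open Classical in
-- Vanishing in all degrees `1, …, n - 1` means membership in `add t`, where every triangle in
-- question splits by rigidity.
lemma isIndexOn_top (hn : 2 ≤ n) : IsIndexOn t ((n : ℤ) - 1)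
    (fun x => if h : addClosure t x then K0Split.cls ⟨x, h⟩ else 0) where
  cls x hx := by simp [hx]
  add {a b c f g δ} h hδ ha hb hc := by
    have ha := hT.mem_of_orth rfl fun i h1 h2 => ha i h1 (by omega)
    have hb := hT.mem_of_orth rfl fun i h1 h2 => hb i h1 (by omega)
    have hc := hT.mem_of_orth rfl fun i h1 h2 => hc i h1 (by omega)
    have := exists_iso_biprod h (hT.orth hc ha le_rfl (by omega) δ)
    simp only [ha, hb, hc, dite_true]
    exact K0Split.cls_eq_add this

/-- Passing to a syzygy gains one degree of vanishing: degree `1` because `f` is an approximation,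
the others by dimension shift. -/
lemma orth_syzygy {v x c : C} {i : v ⟶ x} {f : x ⟶ c} {δ : c ⟶ v⟦(1 : ℤ)⟧}
    (h : Triangle.mk i f δ ∈ distTriang C) (hx : addClosure t x) (hf : IsApprox t f) {m : ℤ}
    (hm : m + 1 < n) (hm0 : 0 ≤ m) (hc : ∀ i, 1 ≤ i → i ≤ m → Orth t c i) :
    ∀ i, 1 ≤ i → i ≤ m + 1 → Orth t v i := by
  intro i h1 h2
  have ho : ∀ i : ℤ, 1 ≤ i → i < n → Orth t x i := fun i h1 h2 =>
    hT.orth (addClosure_self t) hx h1 h2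
  obtain rfl | h3 : i = 1 ∨ 1 ≤ i - 1 := by omega
  · exact hf.orth_one h (ho _ le_rfl (by omega))
  · exact orth₁ h (sub_add_cancel i 1) (ho _ h1 (by omega)) (hc _ h3 (by omega))

/-- The new index of `c` is `[x] - ind v` for an approximation `x ⟶ c` with syzygy `v`, on which
`ind` is already defined. It is well defined by a Schanuel argument and additive by a horseshoe
argument. -/
lemma exists_isIndexOn_pred [IsTriangulated C] {m : ℤ} (hm : m + 1 < n) (hm0 : 0 ≤ m)
    {ind : C → K0Split (addClosure t)} (H : IsIndexOn t (m + 1) ind) :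
    ∃ ind', IsIndexOn t m ind' := by
  choose V X I F D hD hX hF using fun c => hT.exists_approx c
  have ho : ∀ {x : C}, addClosure t x → ∀ i : ℤ, 1 ≤ i → i ≤ m + 1 → Orth t x i :=
    fun hx i h1 h2 => hT.orth (addClosure_self t) hx h1 (by omega)
  -- Schanuel: the homotopy pullback of two approximations of `c` is an extension of each middle
  -- term by the other syzygy.
  have key : ∀ {v x c : C} {i : v ⟶ x} {f : x ⟶ c} {δ : c ⟶ v⟦(1 : ℤ)⟧},
      Triangle.mk i f δ ∈ distTriang C → addClosure t x → IsApprox t f →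
      (∀ i, 1 ≤ i → i ≤ m → Orth t c i) → ind (X c) - ind (V c) = ind x - ind v := by
    intro v x c i f δ h hx hf hc
    obtain ⟨p, a, b, a', b', h1, h2, -⟩ := exists_homotopyPullback h (hD c)
    have hv := orth_syzygy hT h hx hf hm hm0 hc
    have hV := orth_syzygy hT (hD c) (hX c) (hF c) hm hm0 hc
    have hp : ∀ i, 1 ≤ i → i ≤ m + 1 → Orth t p i := fun i k1 k2 =>
      orth₂ h1 (hv i k1 k2) (ho (hX c) i k1 k2)
    have e1 := H.add h1 (((isApprox_iff_killedBy h).1 hf).comp_left _) hv hp (ho (hX c))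
    have e2 := H.add h2 (((isApprox_iff_killedBy (hD c)).1 (hF c)).comp_left _) hV hp (ho hx)
    rw [sub_eq_sub_iff_add_eq_add, add_comm, ← e1, e2, add_comm]
  refine ⟨fun c => ind (X c) - ind (V c), fun x hx => ?_, fun {a b c f g δ} h hδ ha hb hc => ?_⟩
  -- For `x` in `add t` the identity is an approximation with syzygy `0`.
  · rw [key (contractible_distinguished₁ x) hx
      ((isApprox_iff_killedBy (contractible_distinguished₁ x)).2 fun g => comp_zero)
      fun i h1 h2 => ho hx i h1 (by omega)]
    have h0 := isZero_zero C
    have hT0 : addClosure t (0 : C) := hT.of_isZero h0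
    have h00 : ind (0 : C) = 0 := by
      have h' := H.add (contractible_distinguished (0 : C)) (fun g => comp_zero)
        (ho hT0) (ho hT0) (ho hT0)
      simpa using h'
    rw [h00, sub_zero, H.cls x hx]
  -- Horseshoe: `p ≅ a ⊞ X c` since `F c ≫ δ = 0`. Pulling back along `F a` gives `y ≅ X c ⊞ X a`
  -- with an approximation `y ⟶ p ⟶ b`, whose syzygy `w` is an extension of `V c` by `V a`.
  · obtain ⟨p, s, q, s', q', h1, h2, -⟩ := exists_homotopyPullback h (hD c)
    have hz : F c ≫ δ = 0 := hδ.of_addClosure (hX c) _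
    obtain ⟨e⟩ := exists_iso_biprod h1 hz
    have h3 := distinguished_of_iso_biprod (e ≪≫ biprod.braiding _ _)
    obtain ⟨y, k, l, k', l', h4, h5, -⟩ := exists_homotopyPullback (hD a) h3
    have e5 := exists_iso_biprod h5 comp_zero
    have hy : addClosure t y := hT.of_iso (hT.biprod (hX c) (hX a)) e5.some.symm
    obtain ⟨w, κ, η, α, β, h6, h7, -⟩ := exists_cocone_comp h4 h2
    have ka := ((isApprox_iff_killedBy (hD a)).1 (hF a))
    have kc := ((isApprox_iff_killedBy (hD c)).1 (hF c))
    have happ : IsApprox t (l ≫ q') := fun φ => by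
      obtain ⟨ψ, rfl⟩ := (isApprox_iff_killedBy h2).2 (kc.comp_left _) φ
      obtain ⟨χ, rfl⟩ := (isApprox_iff_killedBy h4).2 (ka.comp_left _) ψ
      exact ⟨χ, (Category.assoc _ _ _).symm⟩
    have e6 := H.add h7 ((ka.comp_left _).comp_left _)
      (orth_syzygy hT (hD a) (hX a) (hF a) hm hm0 ha) (orth_syzygy hT h6 hy happ hm hm0 hb)
      (orth_syzygy hT (hD c) (hX c) (hF c) hm hm0 hc)
    have e7 : ind y = ind (X c) + ind (X a) := by
      rw [H.cls _ hy, H.cls _ (hX c), H.cls _ (hX a)]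
      exact K0Split.cls_eq_add e5
    rw [key h6 hy happ hb, e6, e7]
    abel

/-- Descending induction from `n - 1`; at `0` the vanishing conditions are empty, so the index is
additive with no restriction on the objects. -/
lemma exists_isIndexOn_zero [IsTriangulated C] (hn : 2 ≤ n) :
    ∃ ind, IsIndexOn t 0 ind := by
  have : ∀ j : ℕ, j + 1 ≤ n → ∃ ind, IsIndexOn t ((n : ℤ) - 1 - j) ind := by
    intro j
    induction j with
    | zero =>
      intro _
      rw [Nat.cast_zero, sub_zero]
      exact ⟨_, isIndexOn_top hT hn⟩
    | succ j ih =>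
      intro hj
      obtain ⟨ind, h⟩ := ih (by omega)
      refine exists_isIndexOn_pred hT (ind := ind) (by push_cast; omega) (by push_cast; omega) ?_
      convert h using 1
      push_cast
      ring
  obtain ⟨ind, h⟩ := this (n - 1) (by omega)
  refine ⟨ind, ?_⟩
  convert h using 1
  omega

omit hT

/-- The triangulated index with respect to a cluster tilting object `t`: an extension of
`x ↦ [x]` which is additive on the triangles whose last morphism is killed by `C(t, -)`. -/
structure IsTriangulatedIndex (t : C) (ind : C → K0Split (addClosure t)) : Prop where
  cls : ∀ (x : C) (hx : addClosure t x), ind x = K0Split.cls ⟨x, hx⟩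
  add : ∀ {a b c : C} {f : a ⟶ b} {g : b ⟶ c} {δ : c ⟶ a⟦(1 : ℤ)⟧},
    Triangle.mk f g δ ∈ distTriang C → KilledBy t δ → ind b = ind a + ind c

lemma IsClusterTilting.exists_isTriangulatedIndex [IsTriangulated C]
    (hT : IsClusterTilting n (addClosure t)) (hn : 2 ≤ n) :
    ∃ ind, IsTriangulatedIndex t ind := by
  obtain ⟨ind, h⟩ := exists_isIndexOn_zero hT hn
  refine ⟨ind, h.cls, fun h' hδ => h.add h' hδ ?_ ?_ ?_⟩ <;>
  · intro i h1 h2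
    omega

namespace IsTriangulatedIndex

variable {ind : C → K0Split (addClosure t)} (H : IsTriangulatedIndex t ind)
include H

lemma biprod {a b c : C} (e : c ≅ a ⊞ b) : ind c = ind a + ind b :=
  H.add (distinguished_of_iso_biprod e) fun _ => comp_zero

lemma zero : ind (0 : C) = 0 := by
  have h' := H.add (contractible_distinguished (0 : C)) (fun g => comp_zero)
  simpa using h'

lemma iso {a b : C} (e : a ≅ b) : ind a = ind b := by
  have h : Triangle.mk (0 : (0 : C) ⟶ a) e.hom 0 ∈ distTriang C :=
    isomorphic_distinguished _ (contractible_distinguished₁ b) _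
      (Triangle.isoMk _ _ (Iso.refl _) e (Iso.refl _)
        (zero_comp.trans comp_zero.symm) rfl
        (zero_comp.trans comp_zero.symm))
  rw [H.add h fun _ => comp_zero, H.zero, zero_add]

end IsTriangulatedIndex

end Index


/-! ### Minimal approximations and radical morphisms. -/

section MinimalApproximation

/-- Fitting's lemma for an element of a finite dimensional algebra. -/
lemma exists_fitting_idempotent (k : Type*) [Field k] {A : Type*} [Ring A] [Algebra k A]
    [Module.Finite k A] (e : A) :
    ∃ (n : ℕ) (p w : A), p * p = p ∧ (1 - p) * e ^ n = 0 ∧ p = w * e ∧ p = e * w := by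
  obtain ⟨m, hm, he⟩ := Algebra.IsIntegral.isIntegral (R := k) e
  obtain ⟨q, hq, hdvd⟩ := Polynomial.exists_eq_pow_rootMultiplicity_mul_and_not_dvd m hm.ne_zero 0
  rw [Polynomial.C_0, sub_zero] at hq hdvd
  set a := m.rootMultiplicity 0
  -- Here `m = X ^ a * q` with `q` prime to `X`. The exponent `a + 1` makes `u * X ^ (a + 1)` a
  -- multiple of `X` even when `a = 0`, so that the idempotent is a multiple of `e`.
  obtain ⟨u, w, huw⟩ : IsCoprime ((Polynomial.X : Polynomial k) ^ (a + 1)) q :=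
    ((Polynomial.irreducible_X.coprime_iff_not_dvd).2 hdvd).pow_left
  have hz : Polynomial.aeval e (Polynomial.X ^ (a + 1) * q) = 0 := by
    have : (Polynomial.X : Polynomial k) ^ (a + 1) * q = Polynomial.X * m := by
      rw [hq]; ring
    rw [this, map_mul]
    have : Polynomial.aeval e m = 0 := he
    rw [this, mul_zero]
  have h1 : (1 : A) - Polynomial.aeval e (u * Polynomial.X ^ (a + 1)) =
      Polynomial.aeval e (w * q) := by
    rw [← map_one (Polynomial.aeval (R := k) e), ← map_sub, ← huw, add_sub_cancel_left]
  refine ⟨a + 1, Polynomial.aeval e (u * Polynomial.X ^ (a + 1)),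
    Polynomial.aeval e (u * Polynomial.X ^ a), ?_, ?_, ?_, ?_⟩
  · symm
    rw [← sub_eq_zero]
    nth_rewrite 1 [← one_mul (Polynomial.aeval e (u * Polynomial.X ^ (a + 1)))]
    rw [← sub_mul, h1, ← map_mul]
    have : w * q * (u * Polynomial.X ^ (a + 1)) = (w * u) * (Polynomial.X ^ (a + 1) * q) := by
      ring
    rw [this, map_mul, hz, mul_zero]
  · rw [h1]
    nth_rewrite 2 [← Polynomial.aeval_X (R := k) e]
    rw [← map_pow, ← map_mul]
    have : w * q * Polynomial.X ^ (a + 1) = w * (Polynomial.X ^ (a + 1) * q) := by ring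
    rw [this, map_mul, hz, mul_zero]
  · have : u * Polynomial.X ^ (a + 1) = (u * Polynomial.X ^ a) * Polynomial.X := by ring
    rw [this, map_mul _ (u * Polynomial.X ^ a), Polynomial.aeval_X]
  · have : u * Polynomial.X ^ (a + 1) = Polynomial.X * (u * Polynomial.X ^ a) := by ring
    rw [this, map_mul _ Polynomial.X, Polynomial.aeval_X]

variable {C : Type u} [Category.{v} C] [Preadditive C]

/-- If `s` inverts `1 - g ≫ f`, then `1 + f ≫ s ≫ g` inverts `1 - f ≫ g`. -/
lemma isIso_one_sub_comp {X Y : C} (f : X ⟶ Y) (g : Y ⟶ X) (h : IsIso (𝟙 Y - g ≫ f)) :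
    IsIso (𝟙 X - f ≫ g) := by
  set s := inv (𝟙 Y - g ≫ f)
  have h1 : (𝟙 Y - g ≫ f) ≫ s = 𝟙 Y := IsIso.hom_inv_id _
  have h2 : s ≫ (𝟙 Y - g ≫ f) = 𝟙 Y := IsIso.inv_hom_id _
  have h1' : s - g ≫ f ≫ s = 𝟙 Y := by
    rw [← h1, Preadditive.sub_comp, Category.id_comp, Category.assoc]
  have h2' : s - s ≫ g ≫ f = 𝟙 Y := by rw [← h2, Preadditive.comp_sub, Category.comp_id]
  refine ⟨𝟙 X + f ≫ s ≫ g, ?_, ?_⟩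
  · have : f ≫ (s - g ≫ f ≫ s) ≫ g = f ≫ g := by rw [h1', Category.id_comp]
    simp only [Preadditive.sub_comp, Preadditive.comp_sub, Preadditive.comp_add,
      Category.assoc, Category.comp_id, Category.id_comp] at this ⊢
    rw [← sub_eq_zero] at this ⊢
    rw [← this]
    abel
  · have : f ≫ (s - s ≫ g ≫ f) ≫ g = f ≫ g := by rw [h2', Category.id_comp]
    simp only [Preadditive.sub_comp, Preadditive.comp_sub, Preadditive.add_comp,
      Category.assoc, Category.comp_id, Category.id_comp] at this ⊢
    rw [← sub_eq_zero] at this ⊢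
    rw [← this]
    abel

lemma IsRadical.comp_left {X Y Z : C} {f : Y ⟶ Z} (hf : IsRadical f) (a : X ⟶ Y) :
    IsRadical (a ≫ f) := fun g => by
  rw [Category.assoc]
  apply isIso_one_sub_comp
  rw [Category.assoc]
  exact hf _

variable (k : Type w) [Field k] [Linear k C] [∀ X Y : C, Module.Finite k (X ⟶ Y)]

include k in
-- Take an approximation with `End x` of least dimension. If `e ≫ f = f`, the Fitting idempotent of
-- `e` also fixes `f`, so `f` restricts to an approximation from its image. Minimality forces the
-- idempotent to be `1`, and then `e` is invertible.
lemma exists_minimal_approx [HasFiniteBiproducts C] [IsIdempotentComplete C] {t c : C}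
    (h : ∃ (x : C) (f : x ⟶ c), addClosure t x ∧ IsApprox t f) :
    ∃ (x : C) (f : x ⟶ c), addClosure t x ∧ IsApprox t f ∧ ∀ e : x ⟶ x, e ≫ f = f → IsIso e := by
  classical
  have hex : ∃ n, ∃ (x : C) (f : x ⟶ c), addClosure t x ∧ IsApprox t f ∧
      Module.finrank k (x ⟶ x) = n := by
    obtain ⟨x, f, h1, h2⟩ := h
    exact ⟨_, x, f, h1, h2, rfl⟩
  obtain ⟨x, f, hx, hf, hn⟩ := Nat.find_spec hex
  refine ⟨x, f, hx, hf, fun (e : End x) he => ?_⟩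
  have : Module.Finite k (End x) := inferInstanceAs (Module.Finite k (x ⟶ x))
  obtain ⟨n, p, w, hp, hpn, hw, hw'⟩ := exists_fitting_idempotent k (A := End x) e
  have hpow : ∀ n : ℕ, (show x ⟶ x from e ^ n) ≫ f = f := by
    intro n
    induction n with
    | zero => rw [pow_zero]; exact Category.id_comp f
    | succ n ih =>
      rw [pow_succ]
      change ((show x ⟶ x from e) ≫ (show x ⟶ x from e ^ n)) ≫ f = f
      rw [Category.assoc, ih, he]
  -- Multiplication in `End x` is composition in reverse order, so `hpn` must be commuted before it
  -- can be applied to `f`.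
  have hcomm : (1 - p) * e ^ n = e ^ n * (1 - p) := by
    have : Commute e p := by
      change e * p = p * e
      nth_rewrite 1 [hw]
      rw [← mul_assoc, ← hw']
    exact ((Commute.one_left _).sub_left (this.symm)).pow_right n
  have hpf : (p : x ⟶ x) ≫ f = f := by
    have h1 : ((𝟙 x - (show x ⟶ x from p)) ≫ (show x ⟶ x from e ^ n)) ≫ f = 0 := by
      have : (𝟙 x - (show x ⟶ x from p)) ≫ (show x ⟶ x from e ^ n) = 0 := hcomm.symm.trans hpn
      rw [this, zero_comp]
    rw [Category.assoc, hpow, Preadditive.sub_comp, Category.id_comp, sub_eq_zero] at h1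
    exact h1.symm
  obtain ⟨y, i, r, hir, hri⟩ := IsIdempotentComplete.idempotents_split x p hp
  have hy : addClosure t y := addClosure_of_retract hx ⟨i, r, hir⟩
  have hfi : IsApprox t (i ≫ f) := fun g => by
    obtain ⟨h, rfl⟩ := hf g
    exact ⟨h ≫ r, by rw [Category.assoc, ← Category.assoc r, hri, hpf]⟩
  have hle : Module.finrank k (x ⟶ x) ≤ Module.finrank k (y ⟶ y) := by
    rw [hn]
    exact Nat.find_min' hex ⟨y, i ≫ f, hy, hfi, rfl⟩
  -- `L` is injective, hence bijective by the choice of `x`; so `𝟙 x` factors through `y` and `p = 𝟙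
  -- x`.
  let L : (y ⟶ y) →ₗ[k] (x ⟶ x) :=
    { toFun := fun φ => r ≫ φ ≫ i
      map_add' := by intros; simp
      map_smul' := by intros; simp }
  have hL : Function.Injective L := by
    intro φ ψ h
    have h' : i ≫ (r ≫ φ ≫ i) ≫ r = i ≫ (r ≫ ψ ≫ i) ≫ r := by
      change i ≫ L φ ≫ r = i ≫ L ψ ≫ r
      rw [h]
    simpa [hir, reassoc_of% hir] using h'
  have hsurj : Function.Surjective L :=
    (LinearMap.injective_iff_surjective_of_finrank_eq_finrank
      (le_antisymm (LinearMap.finrank_le_finrank_of_injective hL) hle)).1 hL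
  obtain ⟨φ, hφ⟩ := hsurj (𝟙 x)
  have hp1 : p = 𝟙 x := by
    have : p ≫ L φ = L φ := by
      change p ≫ r ≫ φ ≫ i = r ≫ φ ≫ i
      rw [← hri, Category.assoc, reassoc_of% hir]
    rwa [hφ, Category.comp_id] at this
  exact ⟨w, hw.symm.trans hp1, hw'.symm.trans hp1⟩

end MinimalApproximation

/-! ### The angulated index equals the triangulated index. -/

section AngleIndex

variable {C : Type u} [Category.{v} C] [Preadditive C] [HasZeroObject C] [HasShift C ℤ]
  [∀ n : ℤ, (shiftFunctor C n).Additive] [Pretriangulated C]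

/-- As `i ≫ f = 0`, the endomorphism `1 - g ≫ i` of `x` fixes `f` and is therefore invertible. -/
lemma isRadical_of_minimal {v x c : C} {i : v ⟶ x} {f : x ⟶ c} {δ : c ⟶ v⟦(1 : ℤ)⟧}
    (h : Triangle.mk i f δ ∈ distTriang C) (hf : ∀ e : x ⟶ x, e ≫ f = f → IsIso e) :
    IsRadical i := fun g => by
  apply isIso_one_sub_comp
  apply hf
  have : i ≫ f = 0 := comp_distTriang_mor_zero₁₂ _ h
  simp [this, Preadditive.sub_comp]

/-- Telescoping along the tower of triangles of an angle: the inner `v i` cancel in adjacent terms.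
-/
lemma sum_alternating {G : Type*} [AddCommGroup G] (v c : ℕ → G) (d : ℕ) :
    ∑ i : Fin d, (-1 : ℤ) ^ (i : ℕ) • (v (i + 1) - c i + v i) =
      v 0 - ∑ i : Fin d, (-1 : ℤ) ^ (i : ℕ) • c i - (-1 : ℤ) ^ d • v d := by
  induction d with
  | zero => simp
  | succ d ih =>
    rw [Fin.sum_univ_castSucc, Fin.sum_univ_castSucc]
    simp only [Fin.val_castSucc, Fin.val_last]
    rw [ih, pow_succ, mul_neg_one, neg_smul, smul_add, smul_sub]
    abel

variable {S : ObjectProperty C} {d : ℕ} {t : C}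

lemma IsIndex.eq (hT : IsClusterTilting (2 * d) (addClosure t))
    {ind : C → K0Split (addClosure t)} (H : IsTriangulatedIndex t ind) {s : S.FullSubcategory}
    {x : K0Split (addClosure t)} (hx : IsIndex S d t s x) : x = ind s.obj := by
  obtain ⟨top, A, htop, hmid, -, rfl⟩ := hx
  -- Descending from `v d ∈ add t`, which has vanishing in degrees below `2 * d`, each step down the
  -- tower loses one degree. What is left still contains degree `1` of `v (i + 1)`, the target of `δ
  -- i`.
  have horth : ∀ k i : ℕ, i + k = d → ∀ j : ℤ, 1 ≤ j → j < d + i → Orth t (A.v i) j := by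
    intro k
    induction k with
    | zero =>
      rintro i rfl j h1 h2
      exact (hT.orth (addClosure_self t) htop h1 (by push_cast; omega)).of_iso A.topIso.symm
    | succ k ih =>
      intro i hi j h1 h2
      exact orth₃ (A.distinguished i (by omega)) rfl (ih (i + 1) (by omega) _ (by omega)
        (by push_cast; omega)) (hT.orth (addClosure_self t) (hmid ⟨i, by omega⟩) h1
          (by push_cast; omega))
  have hsum := sum_alternating (fun i => ind (A.v i)) (fun i => ind (A.c i)) d
  have hz : ∀ i : Fin d, (-1 : ℤ) ^ (i : ℕ) •
      (ind (A.v (i + 1)) - ind (A.c i) + ind (A.v i)) = 0 := fun i => by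
    have hk : KilledBy t (A.δ i) := fun g =>
      horth (d - (i + 1)) (i + 1) (by omega) 1 le_rfl (by push_cast; omega) _
    rw [H.add (A.distinguished i i.isLt) hk, sub_add_eq_sub_sub, sub_self, zero_sub,
      neg_add_cancel, smul_zero]
  rw [Finset.sum_eq_zero fun i _ => hz i, eq_comm, sub_eq_zero, sub_eq_iff_eq_add'] at hsum
  rw [H.iso A.botIso, hsum, H.iso A.topIso, H.cls _ htop]
  congr 1
  exact Finset.sum_congr rfl fun i _ => by rw [← H.cls _ (hmid i)]; rfl

variable (k : Type w) [Field k] [Linear k C] [∀ X Y : C, Module.Finite k (X ⟶ Y)]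
  [IsIdempotentComplete C]

include k in
-- Iterate minimal approximations. An object of `S` has vanishing in degrees `1, …, d - 1` and each
-- syzygy gains a degree, so the `d`-th syzygy has it up to `2 * d - 1` and lies in `add t`.
lemma exists_isIndex (hS : IsClusterTilting d S) (hd : 1 ≤ d) (htS : S t)
    (hT : IsClusterTilting (2 * d) (addClosure t)) (s : S.FullSubcategory) :
    ∃ x, IsIndex S d t s x := by
  have H : ∀ c : C, ∃ (v x : C) (i : v ⟶ x) (f : x ⟶ c) (δ : c ⟶ v⟦(1 : ℤ)⟧),
      Triangle.mk i f δ ∈ distTriang C ∧ addClosure t x ∧ IsApprox t f ∧ IsRadical i := by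
    intro c
    obtain ⟨-, x, -, f, -, -, h1, h2⟩ := hT.exists_approx c
    obtain ⟨x, f, hx, hf, hm⟩ := exists_minimal_approx k ⟨x, f, h1, h2⟩
    obtain ⟨v, i, δ, h⟩ := distinguished_cocone_triangle₁ f
    exact ⟨v, x, i, f, δ, h, hx, hf, isRadical_of_minimal h hm⟩
  choose V X I F D hD hX hF hI using H
  let v : ℕ → C := fun n => Nat.rec s.obj (fun _ c => V c) n
  have hv : ∀ i : ℕ, i ≤ d → ∀ j : ℤ, 1 ≤ j → j ≤ d + i - 1 → Orth t (v i) j := by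
    intro i
    induction i with
    | zero => exact fun _ j h1 h2 => hS.orth htS s.property h1 (by omega)
    | succ i ih =>
      intro hi j h1 h2
      exact orth_syzygy hT (hD (v i)) (hX _) (hF _) (m := d + i - 1) (by push_cast; omega)
        (by omega) (ih (by omega)) j h1 (by push_cast at h2; omega)
  have hvd : addClosure t (v d) := hT.mem_of_orth rfl fun j h1 h2 =>
    hv d le_rfl j h1 (by push_cast at h2; omega)
  let A : Angle S d ⟨v d, hS.of_addClosure htS hvd⟩ s :=
    { c := fun i => X (v i)
      v := v
      α := fun i => I (v i)
      β := fun i => F (v i)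
      δ := fun i => D (v i)
      distinguished := fun i _ => hD (v i)
      mem := fun i _ => hS.of_addClosure htS (hX _)
      botIso := Iso.refl _
      topIso := Iso.refl _ }
  refine ⟨_, _, A, hvd, fun i => hX _, ⟨fun i _ => (hI (v i)).comp_left _, fun i h => ?_⟩, rfl⟩
  exact ((hI (v i)).comp_left _).comp_left _

include k in
lemma exists_unique_isIndex [IsTriangulated C] (hS : IsClusterTilting d S) (hd : 1 ≤ d)
    (htS : S t) (hT : IsClusterTilting (2 * d) (addClosure t)) (s : S.FullSubcategory) :
    ∃! x, IsIndex S d t s x := by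
  obtain ⟨ind, H⟩ := hT.exists_isTriangulatedIndex (by omega)
  obtain ⟨x, hx⟩ := exists_isIndex k hS hd htS hT s
  exact ⟨x, hx, fun y hy => (hy.eq hT H).trans (hx.eq hT H).symm⟩

include k in
lemma index_eq (hS : IsClusterTilting d S) (hd : 1 ≤ d)
    (htS : S t) (hT : IsClusterTilting (2 * d) (addClosure t))
    {ind : C → K0Split (addClosure t)} (H : IsTriangulatedIndex t ind) (s : S.FullSubcategory) :
    index S d t s = ind s.obj := by
  have h := exists_isIndex k hS hd htS hT s
  rw [index, dif_pos h]
  exact h.choose_spec.eq hT H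

end AngleIndex


/-! ### The functor `C(t, -)` to `Γ`-modules. -/

section ModuleLemmas

lemma nonempty_equiv_of_ker_eq {R M N P : Type*} [Ring R] [AddCommGroup M] [AddCommGroup N]
    [AddCommGroup P] [Module R M] [Module R N] [Module R P] {f : M →ₗ[R] N} {g : M →ₗ[R] P}
    (hf : Function.Surjective f) (hg : Function.Surjective g)
    (h : LinearMap.ker f = LinearMap.ker g) : Nonempty (N ≃ₗ[R] P) :=
  ⟨(f.quotKerEquivOfSurjective hf).symm ≪≫ₗ Submodule.quotEquivOfEq _ _ h ≪≫ₗ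
    g.quotKerEquivOfSurjective hg⟩

variable {C : Type u} [Category.{v} C] [Preadditive C]

/-- The action of `C(t, -)` on morphisms, as a linear map over `Γ = End t`. -/
abbrev mapF (t : C) {X Y : C} (f : X ⟶ Y) : (preadditiveCoyonedaObj t).obj X →ₗ[(End t)ᵐᵒᵖ]
    (preadditiveCoyonedaObj t).obj Y :=
  ((preadditiveCoyonedaObj t).map f).hom

lemma mapF_mapF_eq_zero {t X Y Z : C} {f : X ⟶ Y} {g : Y ⟶ Z} (h : f ≫ g = 0)
    (x : (preadditiveCoyonedaObj t).obj X) : mapF t g (mapF t f x) = 0 := by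
  have : ∀ x : t ⟶ X, (x ≫ f) ≫ g = 0 := fun x => by rw [Category.assoc, h, comp_zero]
  exact this x

lemma range_mapF_comp_left {t X Y Z : C} {p : X ⟶ Y} (hp : IsApprox t p) (f : Y ⟶ Z) :
    LinearMap.range (mapF t (p ≫ f)) = LinearMap.range (mapF t f) := by
  apply le_antisymm
  · rintro _ ⟨g, rfl⟩
    exact ⟨mapF t p g, Category.assoc _ _ _⟩
  · rintro _ ⟨g, rfl⟩
    obtain ⟨g', hg'⟩ := hp g
    exact ⟨g', (Category.assoc g' p f).symm.trans (congrArg (· ≫ f) hg')⟩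

lemma range_mapF_comp_right {t X Y Z : C} (f : X ⟶ Y) {i : Y ⟶ Z}
    (hi : ∀ g : t ⟶ Y, g ≫ i = 0 → g = 0) :
    Nonempty (LinearMap.range (mapF t f) ≃ₗ[(End t)ᵐᵒᵖ] LinearMap.range (mapF t (f ≫ i))) := by
  have hinj : Function.Injective (mapF t i) := (injective_iff_map_eq_zero _).2 hi
  have h : (LinearMap.range (mapF t f)).map (mapF t i) = LinearMap.range (mapF t (f ≫ i)) := by
    rw [← LinearMap.range_comp]
    congr 1
    ext g
    exact Category.assoc _ _ _
  exact ⟨Submodule.equivMapOfInjective _ hinj _ ≪≫ₗ LinearEquiv.ofEq _ _ h⟩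

lemma range_mapF_of_injective {t X Y : C} {i : X ⟶ Y} (hi : ∀ g : t ⟶ X, g ≫ i = 0 → g = 0) :
    Nonempty ((preadditiveCoyonedaObj t).obj X ≃ₗ[(End t)ᵐᵒᵖ] LinearMap.range (mapF t i)) :=
  ⟨LinearEquiv.ofInjective (mapF t i) ((injective_iff_map_eq_zero _).2 hi)⟩

variable [HasFiniteBiproducts C]

/-- The Yoneda lemma for objects of `add t`. -/
lemma addClosure.exists_eq_comp {t x y : C} (hx : addClosure t x)
    (φ : (preadditiveCoyonedaObj t).obj x →ₗ[(End t)ᵐᵒᵖ] (preadditiveCoyonedaObj t).obj y) :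
    ∃ ψ : x ⟶ y, mapF t ψ = φ := by
  obtain ⟨n, p, q, h⟩ := hx.exists_sum
  refine ⟨∑ j, p j ≫ (show t ⟶ y from φ (q j)), ?_⟩
  ext g
  have hg : g = ∑ j, MulOpposite.op (show End t from (show t ⟶ x from g) ≫ p j) •
      (show (preadditiveCoyonedaObj t).obj x from q j) := by
    have : ∀ g : t ⟶ x, g = ∑ j, (g ≫ p j) ≫ q j := fun g => by
      simp only [Category.assoc]
      rw [← Preadditive.comp_sum, h, Category.comp_id]
    exact this g
  have hφ : φ g = ∑ j, MulOpposite.op (show End t from (show t ⟶ x from g) ≫ p j) •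
      φ (q j) := by
    conv_lhs => rw [hg, map_sum]
    exact Finset.sum_congr rfl fun j _ => map_smul _ _ _
  rw [hφ]
  have (g : t ⟶ x) (l : Fin n → (t ⟶ y)) :
      g ≫ ∑ j, p j ≫ l j = ∑ j, (g ≫ p j) ≫ l j := by
    simp only [Category.assoc, Preadditive.comp_sum]
  exact this g fun j => φ (q j)

lemma exists_surjective_of_finite (t : C) (M : Type v) [AddCommGroup M] [Module (End t)ᵐᵒᵖ M]
    [Module.Finite (End t)ᵐᵒᵖ M] :
    ∃ (x : C) (_ : addClosure t x) (f : (preadditiveCoyonedaObj t).obj x →ₗ[(End t)ᵐᵒᵖ] M),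
      Function.Surjective f := by
  obtain ⟨n, s, hs⟩ := Module.Finite.exists_fin (R := (End t)ᵐᵒᵖ) (M := M)
  let P : Fin n → C := fun _ => t
  let L : (preadditiveCoyonedaObj t).obj (⨁ P) →ₗ[(End t)ᵐᵒᵖ] M :=
    { toFun := fun g => ∑ j, MulOpposite.op (show End t from (show t ⟶ ⨁ P from g) ≫
        biproduct.π P j) • s j
      map_add' := fun g g' => by
        rw [← Finset.sum_add_distrib]
        refine Finset.sum_congr rfl fun j _ => ?_
        rw [← add_smul]
        congr 1
        exact congrArg MulOpposite.op (Preadditive.add_comp _ _ _ _ _ _)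
      map_smul' := fun r g => by
        rw [RingHom.id_apply, Finset.smul_sum]
        refine Finset.sum_congr rfl fun j _ => ?_
        rw [smul_smul]
        congr 1
        exact congrArg MulOpposite.op (Category.assoc _ _ _) }
  refine ⟨⨁ P, addClosure_biproduct t n, L, ?_⟩
  rw [← LinearMap.range_eq_top, eq_top_iff, ← hs, Submodule.span_le]
  rintro _ ⟨j, rfl⟩
  refine ⟨biproduct.ι P j, ?_⟩
  change ∑ i, MulOpposite.op (show End t from biproduct.ι P j ≫ biproduct.π P i) • s i = s j
  rw [Finset.sum_eq_single j]
  · rw [biproduct.ι_π_self]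
    exact one_smul _ _
  · intro i _ hij
    rw [biproduct.ι_π_ne P hij.symm]
    exact zero_smul _ _
  · simp

end ModuleLemmas

/-! ### The error term on modules and its additivity. -/

section Theta

variable {C : Type u} [Category.{v} C] [Preadditive C] [HasZeroObject C] [HasShift C ℤ]
  [∀ n : ℤ, (shiftFunctor C n).Additive] [Pretriangulated C]

/-- The object `n[1]` is the cone of a morphism between objects of `add t`. -/
def IsPresented (t n : C) : Prop :=
  ∃ (x y : C) (i : n ⟶ x) (f : x ⟶ y) (η : y ⟶ n⟦(1 : ℤ)⟧), addClosure t x ∧ addClosure t y ∧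
    Triangle.mk i f η ∈ distTriang C

variable {t : C}

/-- The functor `C(t, -)` is full on the cones of morphisms in `add t`. -/
lemma IsPresented.exists_eq_mapF {n y : C} (hn : IsPresented t n)
    (φ : (preadditiveCoyonedaObj t).obj (n⟦(1 : ℤ)⟧) →ₗ[(End t)ᵐᵒᵖ]
      (preadditiveCoyonedaObj t).obj y) (hrigid : ∀ x, addClosure t x → Orth t x 1) :
    ∃ h : n⟦(1 : ℤ)⟧ ⟶ y, mapF t h = φ := by
  obtain ⟨x₁, x₀, i, f, η, h₁, h₀, h⟩ := hn
  -- Lift `φ` to the projective cover term `x₀` by Yoneda; the lift vanishes on `f`, hence factors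
  -- through the cone.
  obtain ⟨ψ, hψ⟩ := h₀.exists_eq_comp (φ ∘ₗ mapF t η)
  have hfη : f ≫ η = 0 := comp_distTriang_mor_zero₂₃ _ h
  have hz : f ≫ ψ = 0 := by
    have : KilledBy t (f ≫ ψ) := fun g => by
      rw [← Category.assoc]
      exact (LinearMap.congr_fun hψ (g ≫ f)).trans
        ((congrArg φ (mapF_mapF_eq_zero hfη _)).trans (map_zero φ))
    simpa using this.of_addClosure h₁ (𝟙 _)
  obtain ⟨h', hh'⟩ := Triangle.yoneda_exact₃ _ h ψ hz
  refine ⟨h', ?_⟩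
  ext g
  obtain ⟨g', rfl⟩ := Triangle.coyoneda_exact₃ _ (rot_of_distTriang _ h) g
    (hrigid _ h₁ _)
  refine Eq.trans ?_ (LinearMap.congr_fun hψ g')
  rw [hh']
  exact Category.assoc g' η h'

/-- The sum of the triangulated indices of `n[1]` and `n`. -/
def indexSum (ind : C → K0Split (addClosure t)) (n : C) : K0Split (addClosure t) :=
  ind n + ind (n⟦(1 : ℤ)⟧)

variable {ind : C → K0Split (addClosure t)} (H : IsTriangulatedIndex t ind)
include H

/-- With `q` the cone of `f : x ⟶ y`, injectivity of `F(f[1])` gives `ind y = ind x + ind q` and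
surjectivity gives `ind x[1] = ind q + ind y[1]`; the two errors cancel. -/
lemma IsTriangulatedIndex.indexSum_eq {x y : C} (h : x⟦(1 : ℤ)⟧ ⟶ y⟦(1 : ℤ)⟧)
    (hh : Function.Bijective (mapF t h)) : indexSum ind x = indexSum ind y := by
  obtain ⟨f, rfl⟩ := (shiftFunctor C (1 : ℤ)).map_surjective h
  obtain ⟨q, g, δ, hq⟩ := distinguished_cocone_triangle f
  have hδf : δ ≫ f⟦(1 : ℤ)⟧' = 0 := comp_distTriang_mor_zero₃₁ _ hq
  have h1 := H.add hq fun φ => by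
    exact (injective_iff_map_eq_zero _).1 hh.1 _ (mapF_mapF_eq_zero hδf φ)
  have h2 := H.add (rot_of_distTriang _ (rot_of_distTriang _ hq)) ((isApprox_iff_killedBy
    (rot_of_distTriang _ (rot_of_distTriang _ hq))).1 fun φ => by
      obtain ⟨ψ, hψ⟩ := hh.2 φ
      refine ⟨-(show t ⟶ _ from ψ), ?_⟩
      change (-(show t ⟶ _ from ψ)) ≫ (-f⟦(1 : ℤ)⟧') = φ
      rw [Preadditive.neg_comp, Preadditive.comp_neg, neg_neg]
      exact hψ)
  change ind (x⟦(1 : ℤ)⟧) = ind q + ind (y⟦(1 : ℤ)⟧) at h2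
  rw [indexSum, indexSum, h1, h2]
  abel

/-- Approximate `c` by `x₀`, form the homotopy pullback `p` of `b` and `x₀` over `c`, and
approximate `p` by `x₁`. The cocone `n` of `x₁ ⟶ p ⟶ x₀` maps to `a`; `F` is onto on `x₀ ⟶ n[1]` and
injective on `n[1] ⟶ a[1]`, and the composite of these is `f₀ ≫ γ`, so `F(n[1])` is `Im F γ`. -/
lemma IsTriangulatedIndex.exists_presented [IsTriangulated C] {m : ℕ}
    (hT : IsClusterTilting m (addClosure t)) (hm : 2 ≤ m) {a b c : C} {f : a ⟶ b} {g : b ⟶ c}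
    {γ : c ⟶ a⟦(1 : ℤ)⟧} (h : Triangle.mk f g γ ∈ distTriang C) :
    ∃ n, IsPresented t n ∧ Nonempty ((preadditiveCoyonedaObj t).obj (n⟦(1 : ℤ)⟧)
      ≃ₗ[(End t)ᵐᵒᵖ] LinearMap.range (mapF t γ)) ∧
      ind a - ind b + ind c = indexSum ind n := by
  obtain ⟨z, x₀, i₀, f₀, δ₀, h₀, hx₀, hf₀⟩ := hT.exists_approx c
  obtain ⟨p, a', b', z', l, hp, hp', -⟩ := exists_homotopyPullback h h₀
  obtain ⟨w, x₁, i₁, f₁, δ₁, h₁, hx₁, hf₁⟩ := hT.exists_approx p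
  have kf₀ := (isApprox_iff_killedBy h₀).1 hf₀
  have kf₁ := (isApprox_iff_killedBy h₁).1 hf₁
  obtain ⟨n, s, η, u, v, hn, huv, hη⟩ := exists_cocone_comp h₁ hp
  have hoη : ∀ φ : t ⟶ n⟦(1 : ℤ)⟧, ∃ ψ, φ = ψ ≫ η := fun φ =>
    Triangle.coyoneda_exact₃ _ (rot_of_distTriang _ hn) φ
      (hT.orth (addClosure_self t) hx₁ le_rfl (by omega) _)
  have hcη : (f₁ ≫ b') ≫ η = 0 := comp_distTriang_mor_zero₂₃ _ hn
  have hinj : ∀ φ : t ⟶ n⟦(1 : ℤ)⟧, φ ≫ v⟦(1 : ℤ)⟧' = 0 → φ = 0 := fun φ hφ => by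
    obtain ⟨ψ, rfl⟩ := hoη φ
    rw [Category.assoc, hη] at hφ
    obtain ⟨χ, hχ⟩ := Triangle.coyoneda_exact₃ _ hp ψ hφ
    obtain ⟨ω, rfl⟩ := hf₁ χ
    change ψ = (ω ≫ f₁) ≫ b' at hχ
    rw [hχ, Category.assoc, Category.assoc, ← Category.assoc f₁, hcη, comp_zero]
  refine ⟨n, ⟨x₁, x₀, s, _, η, hx₁, hx₀, hn⟩, ?_, ?_⟩
  · obtain ⟨e⟩ := range_mapF_of_injective hinj
    rw [← range_mapF_comp_left hf₀ γ, ← hη,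
      range_mapF_comp_left fun φ => (hoη φ).imp fun _ h => h.symm]
    exact ⟨e⟩
  · have e1 := H.add hp' (kf₀.comp_left _)
    have e2 := H.add h₀ kf₀
    have e3 := H.add h₁ kf₁
    have e4 := H.add huv (kf₁.comp_left _)
    have e5 := H.add (rot_of_distTriang _ hn) fun φ =>
      hT.orth (addClosure_self t) hx₁ le_rfl (by omega) _
    change ind x₀ = ind x₁ + ind (n⟦(1 : ℤ)⟧) at e5
    have e6 : ind c = ind x₀ - ind z := by rw [e2]; abel
    have e7 : ind b = ind p - ind z := by rw [e1]; abel
    rw [indexSum, e6, e7, e4, e5, e3]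
    abel

omit H

open Classical in
/-- The value of `θ` on the class of a module `M`: the sum of the indices of `n[1]` and `n`, where
`M ≅ C(t, n[1])` and `n[1]` is the cone of a morphism in `add t`. -/
noncomputable def thetaObj (ind : C → K0Split (addClosure t)) (M : Type v) [AddCommGroup M]
    [Module (End t)ᵐᵒᵖ M] : K0Split (addClosure t) :=
  if h : ∃ n, IsPresented t n ∧
      Nonempty ((preadditiveCoyonedaObj t).obj (n⟦(1 : ℤ)⟧) ≃ₗ[(End t)ᵐᵒᵖ] M) then
    indexSum ind h.choose else 0

variable {M : Type v} [AddCommGroup M] [Module (End t)ᵐᵒᵖ M]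
variable {m : ℕ} (hT : IsClusterTilting m (addClosure t)) (hm : 2 ≤ m)
include H hT hm

/-- The choice of `n` is immaterial: an isomorphism between the modules of two choices lifts to a
morphism, by fullness, and `indexSum_eq` applies. -/
lemma IsTriangulatedIndex.thetaObj_eq_indexSum {n : C} (hn : IsPresented t n)
    (e : (preadditiveCoyonedaObj t).obj (n⟦(1 : ℤ)⟧) ≃ₗ[(End t)ᵐᵒᵖ] M) :
    thetaObj ind M = indexSum ind n := by
  have h : ∃ n, IsPresented t n ∧
      Nonempty ((preadditiveCoyonedaObj t).obj (n⟦(1 : ℤ)⟧) ≃ₗ[(End t)ᵐᵒᵖ] M) := ⟨n, hn, ⟨e⟩⟩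
  rw [thetaObj, dif_pos h]
  obtain ⟨h1, ⟨e'⟩⟩ := h.choose_spec
  obtain ⟨f, hf⟩ := h1.exists_eq_mapF (e' ≪≫ₗ e.symm).toLinearMap fun x hx =>
    hT.orth (addClosure_self t) hx le_rfl (by omega)
  refine H.indexSum_eq f ?_
  rw [hf]
  exact (e' ≪≫ₗ e.symm).bijective

lemma IsTriangulatedIndex.triangle_eq [IsTriangulated C] {a b c : C} {f : a ⟶ b} {g : b ⟶ c}
    {γ : c ⟶ a⟦(1 : ℤ)⟧} (h : Triangle.mk f g γ ∈ distTriang C)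
    (e : LinearMap.range (mapF t γ) ≃ₗ[(End t)ᵐᵒᵖ] M) :
    ind a - ind b + ind c = thetaObj ind M := by
  obtain ⟨n, hn, ⟨e'⟩, hsum⟩ := H.exists_presented hT hm h
  rw [hsum, H.thetaObj_eq_indexSum hT hm hn (e' ≪≫ₗ e)]

omit H
variable (k : Type w) [Field k] [Linear k C] [∀ X Y : C, Module.Finite k (X ⟶ Y)]

include k in
-- A projective presentation of `M` lifts to a morphism in `add t`, whose cone is `n[1]`.
lemma exists_presentation (M : Type v) [AddCommGroup M] [Module (End t)ᵐᵒᵖ M]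
    [Module.Finite (End t)ᵐᵒᵖ M] : ∃ n, IsPresented t n ∧
      Nonempty ((preadditiveCoyonedaObj t).obj (n⟦(1 : ℤ)⟧) ≃ₗ[(End t)ᵐᵒᵖ] M) := by
  obtain ⟨x₀, hx₀, p, hp⟩ := exists_surjective_of_finite t M
  have := finite_submodule k t x₀ (LinearMap.ker p)
  obtain ⟨x₁, hx₁, q, hq⟩ := exists_surjective_of_finite t (LinearMap.ker p)
  obtain ⟨f, hf⟩ := hx₁.exists_eq_comp ((LinearMap.ker p).subtype ∘ₗ q)
  obtain ⟨n, i, η, h⟩ := distinguished_cocone_triangle₁ f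
  refine ⟨n, ⟨x₁, x₀, i, f, η, hx₁, hx₀, h⟩, ?_⟩
  have hη : Function.Surjective (mapF t η) := fun φ => by
    obtain ⟨ψ, hψ⟩ := Triangle.coyoneda_exact₃ _ (rot_of_distTriang _ h) φ
      (hT.orth (addClosure_self t) hx₁ le_rfl (by omega) _)
    exact ⟨ψ, hψ.symm⟩
  refine nonempty_equiv_of_ker_eq hη hp ?_
  have h1 : LinearMap.range (mapF t f) = LinearMap.ker p := by
    rw [hf, LinearMap.range_comp, LinearMap.range_eq_top.2 hq, Submodule.map_top,
      Submodule.range_subtype]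
  rw [← h1]
  apply le_antisymm
  · intro φ hφ
    obtain ⟨ψ, hψ⟩ := Triangle.coyoneda_exact₃ _ h φ hφ
    exact ⟨ψ, hψ.symm⟩
  · rintro _ ⟨ψ, rfl⟩
    have hz : f ≫ η = 0 := comp_distTriang_mor_zero₂₃ _ h
    exact mapF_mapF_eq_zero hz ψ

include H k in
-- Lift `g` to `s[1] : n[1] ⟶ n''[1]` and let `q` be the cone of `s`. The image of `F(q ⟶ n[1])` is
-- `ker g ≅ M'`, so the triangle on `s` computes the term of `M'`; surjectivity of `g` makes `ind`
-- additive on the rotated triangle.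
lemma IsTriangulatedIndex.thetaObj_exact [IsTriangulated C] {M' M M'' : Type v}
    [AddCommGroup M'] [AddCommGroup M] [AddCommGroup M''] [Module (End t)ᵐᵒᵖ M']
    [Module (End t)ᵐᵒᵖ M] [Module (End t)ᵐᵒᵖ M''] [Module.Finite (End t)ᵐᵒᵖ M]
    [Module.Finite (End t)ᵐᵒᵖ M''] (f : M' →ₗ[(End t)ᵐᵒᵖ] M) (g : M →ₗ[(End t)ᵐᵒᵖ] M'')
    (hf : Function.Injective f) (hfg : Function.Exact f g) (hg : Function.Surjective g) :
    thetaObj ind M = thetaObj ind M' + thetaObj ind M'' := by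
  obtain ⟨n, hn, ⟨e⟩⟩ := exists_presentation hT hm k M
  obtain ⟨n'', hn'', ⟨e''⟩⟩ := exists_presentation hT hm k M''
  obtain ⟨h, hh⟩ := hn.exists_eq_mapF (e''.symm.toLinearMap ∘ₗ g ∘ₗ e.toLinearMap) fun x hx =>
    hT.orth (addClosure_self t) hx le_rfl (by omega)
  obtain ⟨s, rfl⟩ := (shiftFunctor C (1 : ℤ)).map_surjective h
  obtain ⟨q, α, β, hq⟩ := distinguished_cocone_triangle s
  have hrange : LinearMap.range (e.symm.toLinearMap ∘ₗ f) = LinearMap.range (mapF t β) := by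
    ext φ
    have h1 : φ ∈ LinearMap.range (e.symm.toLinearMap ∘ₗ f) ↔ g (e φ) = 0 := by
      rw [hfg (e φ)]
      constructor
      · rintro ⟨x, rfl⟩
        exact ⟨x, by simp⟩
      · rintro ⟨x, hx⟩
        exact ⟨x, by simp [hx]⟩
    have h2 : g (e φ) = 0 ↔ mapF t (s⟦(1 : ℤ)⟧') φ = 0 := by
      rw [hh]
      simp
    rw [h1, h2]
    constructor
    · intro hφ
      obtain ⟨ψ, hψ⟩ := Triangle.coyoneda_exact₁ _ hq φ hφ
      exact ⟨ψ, hψ.symm⟩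
    · rintro ⟨ψ, rfl⟩
      have hz : β ≫ s⟦(1 : ℤ)⟧' = 0 := comp_distTriang_mor_zero₃₁ _ hq
      exact mapF_mapF_eq_zero hz ψ
  have e1 := H.triangle_eq hT hm hq ((LinearEquiv.ofInjective (e.symm.toLinearMap ∘ₗ f)
    (e.symm.injective.comp hf)) ≪≫ₗ LinearEquiv.ofEq _ _ hrange).symm
  have e2 := H.add (rot_of_distTriang _ (rot_of_distTriang _ hq)) ((isApprox_iff_killedBy
    (rot_of_distTriang _ (rot_of_distTriang _ hq))).1 fun φ => by
      obtain ⟨ψ, hψ⟩ : ∃ ψ, mapF t (s⟦(1 : ℤ)⟧') ψ = φ := by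
        rw [hh]
        exact (e''.symm.surjective.comp (hg.comp e.surjective)) φ
      refine ⟨-(show t ⟶ _ from ψ), ?_⟩
      change (-(show t ⟶ _ from ψ)) ≫ (-s⟦(1 : ℤ)⟧') = φ
      rw [Preadditive.neg_comp, Preadditive.comp_neg, neg_neg]
      exact hψ)
  change ind (n⟦(1 : ℤ)⟧) = ind q + ind (n''⟦(1 : ℤ)⟧) at e2
  rw [← e1, H.thetaObj_eq_indexSum hT hm hn e, H.thetaObj_eq_indexSum hT hm hn'' e'', indexSum,
    indexSum, e2]
  abel

include H k in
lemma IsTriangulatedIndex.exists_theta [IsTriangulated C] :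
    ∃ θ : K0Mod (End t)ᵐᵒᵖ →+ K0Split (addClosure t),
      ∀ M : FGModuleCat.{v} (End t)ᵐᵒᵖ, θ (K0Mod.cls M) = thetaObj ind M := by
  refine ⟨QuotientAddGroup.lift _ (FreeAbelianGroup.lift fun M : FGModuleCat.{v} (End t)ᵐᵒᵖ =>
    thetaObj ind M) ?_, fun M => ?_⟩
  · rw [exactRelations, AddSubgroup.closure_le]
    rintro _ ⟨M', M, M'', f, g, hf, hfg, hg, rfl⟩
    change FreeAbelianGroup.lift _ _ = 0
    rw [map_sub, map_add, FreeAbelianGroup.lift_apply_of, FreeAbelianGroup.lift_apply_of,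
      FreeAbelianGroup.lift_apply_of, H.thetaObj_exact hT hm k f g hf hfg hg, sub_self]
  · exact FreeAbelianGroup.lift_apply_of _ _

end Theta


/-! ### The alternating index sum of an angle. -/

section AngleTheta

variable {C : Type u} [Category.{v} C] [Preadditive C] [HasZeroObject C] [HasShift C ℤ]
  [∀ n : ℤ, (shiftFunctor C n).Additive] [Pretriangulated C]

omit [HasZeroObject C] [HasShift C ℤ] [∀ n : ℤ, (shiftFunctor C n).Additive]
  [Pretriangulated C] in
lemma injective_comp_isIso {t X Y : C} (i : X ⟶ Y) [IsIso i] (g : t ⟶ X) (h : g ≫ i = 0) :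
    g = 0 := by
  rw [← cancel_mono i, h, zero_comp]

lemma injective_comp_shift {t a b c : C} {f : a ⟶ b} {g : b ⟶ c} {δ : c ⟶ a⟦(1 : ℤ)⟧}
    (h : Triangle.mk f g δ ∈ distTriang C) {j : ℤ} (hb : Orth t b j) (φ : t ⟶ c⟦j⟧)
    (hφ : φ ≫ δ⟦j⟧' = 0) : φ = 0 := by
  obtain ⟨ψ, hψ⟩ := Triangle.coyoneda_exact₃ _ (Triangle.shift_distinguished _ h j) φ (by
    change φ ≫ (j.negOnePow • (δ⟦j⟧' ≫ (shiftFunctorComm C 1 j).hom.app a)) = 0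
    rw [Linear.comp_units_smul, ← Category.assoc, hφ, zero_comp, smul_zero])
  rw [hψ, hb ψ]
  exact zero_comp

variable {S : ObjectProperty C} {d : ℕ} {t : C}

namespace Angle

variable {top bot : S.FullSubcategory} (A : Angle S d top bot)

/-- The vanishing shrinks by one degree per step down from `v d ∈ S`. It kills `δ i` for `i ≥ 1` but
says nothing about `δ 0`. -/
lemma orth_v (hS : IsClusterTilting d S) (htS : S t) :
    ∀ k i : ℕ, i + k = d → ∀ j : ℤ, 1 ≤ j → j < i → Orth t (A.v i) j := by
  intro k
  induction k with
  | zero =>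
    rintro i rfl j h1 h2
    exact (hS.orth htS top.property h1 (by push_cast; omega)).of_iso A.topIso.symm
  | succ k ih =>
    intro i hi j h1 h2
    exact orth₃ (A.distinguished i (by omega)) rfl (ih (i + 1) (by omega) _ (by omega)
      (by push_cast; omega)) (hS.orth htS (A.mem i (by omega)) h1 (by omega))

/-- For `1 ≤ j < d` the functor `F` is injective on `Σ^j δ_j`, because `C(t, Σ^j c_j) = 0`; only `δ
0` affects the image. -/
lemma range_connecting (hS : IsClusterTilting d S) (htS : S t) : ∀ j : ℕ, j + 1 ≤ d →
    Nonempty (LinearMap.range (mapF t (A.δ 0)) ≃ₗ[(End t)ᵐᵒᵖ]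
      LinearMap.range (mapF t (A.connecting (j + 1)))) := by
  intro j
  induction j with
  | zero =>
    intro _
    have h : A.connecting 1 = A.δ 0 ≫ (shiftFunctorZero' C ((0 : ℕ) : ℤ) rfl).inv.app _ ≫
        (shiftFunctorAdd' C (1 : ℤ) ((0 : ℕ) : ℤ) ((0 + 1 : ℕ) : ℤ) (by simp)).inv.app
          (A.v 1) := by
      rw [← Category.assoc]
      have : A.δ 0 ≫ (shiftFunctorZero' C ((0 : ℕ) : ℤ) rfl).inv.app _ =
          (shiftFunctorZero' C ((0 : ℕ) : ℤ) rfl).inv.app _ ≫ (A.δ 0)⟦((0 : ℕ) : ℤ)⟧' :=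
        (shiftFunctorZero' C ((0 : ℕ) : ℤ) rfl).inv.naturality (A.δ 0)
      rw [this, Category.assoc]
      rfl
    rw [h]
    exact range_mapF_comp_right _ (injective_comp_isIso _)
  | succ j ih =>
    intro hj
    obtain ⟨e⟩ := ih (by omega)
    obtain ⟨e'⟩ := range_mapF_comp_right (t := t) (A.connecting (j + 1))
      (i := (A.δ (j + 1))⟦((j + 1 : ℕ) : ℤ)⟧' ≫
        (shiftFunctorAdd' C (1 : ℤ) ((j + 1 : ℕ) : ℤ) ((j + 1 + 1 : ℕ) : ℤ)
          (by push_cast; ring)).inv.app (A.v (j + 1 + 1))) fun φ hφ => by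
        rw [← Category.assoc] at hφ
        exact injective_comp_shift (A.distinguished (j + 1) (by omega))
          (hS.orth htS (A.mem (j + 1) (by omega)) (by push_cast; omega) (by push_cast; omega)) _
          (injective_comp_isIso _ _ hφ)
    exact ⟨e ≪≫ₗ e'⟩

lemma range_γ (hd : 1 ≤ d) (hS : IsClusterTilting d S) (htS : S t) :
    Nonempty (LinearMap.range (mapF t (A.δ 0)) ≃ₗ[(End t)ᵐᵒᵖ]
      LinearMap.range (mapF t A.γ)) := by
  obtain ⟨j, rfl⟩ : ∃ j, d = j + 1 := ⟨d - 1, by omega⟩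
  obtain ⟨e⟩ := A.range_connecting hS htS j le_rfl
  obtain ⟨e'⟩ := range_mapF_comp_right (t := t) (A.connecting (j + 1))
    (i := A.topIso.hom⟦((j + 1 : ℕ) : ℤ)⟧') (injective_comp_isIso _)
  rw [Angle.γ, range_mapF_comp_left fun φ => ⟨φ ≫ A.botIso.inv, by simp⟩]
  exact ⟨e ≪≫ₗ e'⟩

lemma sum_index (hd : 1 ≤ d) (hS : IsClusterTilting d S) (htS : S t)
    {m : ℕ} (hT : IsClusterTilting m (addClosure t)) (hm : 2 ≤ m) [IsTriangulated C]
    {ind : C → K0Split (addClosure t)} (H : IsTriangulatedIndex t ind) :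
    ind bot.obj + ∑ i : Fin d, (-1 : ℤ) ^ ((i : ℕ) + 1) • ind (A.obj i).obj +
      (-1 : ℤ) ^ (d + 1) • ind top.obj = thetaObj ind (LinearMap.range (mapF t A.γ)) := by
  have hsum := sum_alternating (fun i => ind (A.v i)) (fun i => ind (A.c i)) d
  rw [Finset.sum_eq_single (⟨0, hd⟩ : Fin d)] at hsum
  · obtain ⟨e⟩ := A.range_γ hd hS htS
    have h0 := H.triangle_eq hT hm (A.distinguished 0 hd) e
    rw [pow_zero, one_smul, h0] at hsum
    rw [hsum, H.iso A.botIso, ← H.iso A.topIso, sub_eq_add_neg, sub_eq_add_neg,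
      ← Finset.sum_neg_distrib]
    simp only [pow_succ, mul_neg_one, neg_smul]
    rfl
  · intro i _ hi
    have hi' : 1 ≤ (i : ℕ) := by
      rw [ne_eq, Fin.ext_iff] at hi
      exact Nat.one_le_iff_ne_zero.2 hi
    have hk : KilledBy t (A.δ i) := fun g =>
      A.orth_v hS htS (d - (i + 1)) (i + 1) (by omega) 1 le_rfl (by push_cast; omega) _
    rw [H.add (A.distinguished i i.isLt) hk, sub_add_eq_sub_sub, sub_self, zero_sub,
      neg_add_cancel, smul_zero]
  · intro h
    exact absurd (Finset.mem_univ _) h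

end Angle

variable (k : Type w) [Field k] [Linear k C] [∀ X Y : C, Module.Finite k (X ⟶ Y)]
  [IsIdempotentComplete C]

lemma exists_isTheta [IsTriangulated C] (hS : IsClusterTilting d S) (hd : 1 ≤ d)
    (htS : S t) (hT : IsClusterTilting (2 * d) (addClosure t)) : ∃ θ, IsTheta k S d t θ := by
  obtain ⟨ind, H⟩ := hT.exists_isTriangulatedIndex (by omega)
  obtain ⟨θ, hθ⟩ := H.exists_theta hT (by omega) k
  refine ⟨θ, fun top bot A => ?_⟩
  rw [hθ]
  simp only [index_eq k hS hd htS hT H]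
  exact A.sum_index hd hS htS hT (by omega) H

end AngleTheta


/-! ### Every morphism `s ⟶ Σ^d s'` ends an angle. -/

section AngleExistence

variable {C : Type u} [Category.{v} C] [Preadditive C] [HasZeroObject C] [HasShift C ℤ]
  [∀ n : ℤ, (shiftFunctor C n).Additive] [Pretriangulated C]

/-- Shifting a triangle by `1` negates its morphisms; the signs are absorbed by `-1` on the middle
object and in `h'`. -/
lemma exists_desuspension {x y z c : C} {f : x⟦(1 : ℤ)⟧ ⟶ y⟦(1 : ℤ)⟧} {g : y⟦(1 : ℤ)⟧ ⟶ c}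
    {h : c ⟶ (x⟦(1 : ℤ)⟧)⟦(1 : ℤ)⟧} (H : Triangle.mk f g h ∈ distTriang C) (e : c ≅ z⟦(1 : ℤ)⟧) :
    ∃ (f' : x ⟶ y) (g' : y ⟶ z) (h' : z ⟶ x⟦(1 : ℤ)⟧), Triangle.mk f' g' h' ∈ distTriang C ∧
      g'⟦(1 : ℤ)⟧' = g ≫ e.hom := by
  obtain ⟨f', rfl⟩ := (shiftFunctor C (1 : ℤ)).map_surjective f
  obtain ⟨g', hg'⟩ := (shiftFunctor C (1 : ℤ)).map_surjective (g ≫ e.hom)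
  obtain ⟨h', hh'⟩ := (shiftFunctor C (1 : ℤ)).map_surjective
    (-(e.inv ≫ h ≫ (shiftFunctorComm C (1 : ℤ) 1).inv.app x))
  refine ⟨f', g', h', ?_, hg'⟩
  rw [← Triangle.shift_distinguished_iff _ (1 : ℤ)]
  refine isomorphic_distinguished _ H _ (Iso.symm ?_)
  have hneg (X : C) : (-𝟙 X) ≫ (-𝟙 X) = 𝟙 X := by simp
  refine Triangle.isoMk _ _ (Iso.refl _) ⟨-𝟙 _, -𝟙 _, hneg _, hneg _⟩ e ?_ ?_ ?_
  · change f'⟦(1 : ℤ)⟧' ≫ (-𝟙 _) = 𝟙 _ ≫ ((1 : ℤ).negOnePow • f'⟦(1 : ℤ)⟧')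
    simp
  · change g ≫ e.hom = (-𝟙 _) ≫ ((1 : ℤ).negOnePow • g'⟦(1 : ℤ)⟧')
    rw [hg']
    simp
  · change h ≫ (𝟙 _)⟦(1 : ℤ)⟧' = e.hom ≫ ((1 : ℤ).negOnePow • (h'⟦(1 : ℤ)⟧' ≫
      (shiftFunctorComm C (1 : ℤ) 1).hom.app x))
    rw [hh']
    simp

/-- A triangle `w ⟶ v ⟶ Σ^j x ⟶ Σ w`; the objects from which a `(d+2)`-angle is built. -/
structure AngleState (x : C) (j : ℤ) where
  w : C
  v : C
  f : w ⟶ v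
  g : v ⟶ x⟦j⟧
  h : x⟦j⟧ ⟶ w⟦(1 : ℤ)⟧
  mem : Triangle.mk f g h ∈ distTriang C

/-- One storey of the tower, from the octahedral axiom for `c ⟶ w ⟶ v`. The last identity lets the
original morphism be recovered from the connecting morphisms. -/
lemma AngleState.exists_next [IsTriangulated C] {x : C} {i j : ℤ} (hij : i + 1 = j)
    (s : AngleState x j) {w c : C} {a : w ⟶ c} {b : c ⟶ s.w} {δ : s.w ⟶ w⟦(1 : ℤ)⟧}
    (h : Triangle.mk a b δ ∈ distTriang C) :
    ∃ (s' : AngleState x i) (α : s'.v ⟶ c) (η : s.v ⟶ s'.v⟦(1 : ℤ)⟧),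
      s'.w = w ∧ Triangle.mk α (b ≫ s.f) η ∈ distTriang C ∧
      η ≫ s'.g⟦(1 : ℤ)⟧' ≫ (shiftFunctorAdd' C i 1 j hij).inv.app x = s.g := by
  obtain ⟨p, k, η, hp⟩ := distinguished_cocone_triangle₁ (b ≫ s.f)
  let o := Triangulated.someOctahedron (rfl : b ≫ s.f = b ≫ s.f) (rot_of_distTriang _ h) s.mem
    (rot_of_distTriang _ hp)
  obtain ⟨m₁, m₃, n, hm, hη⟩ : ∃ (m₁ : w⟦(1 : ℤ)⟧ ⟶ p⟦(1 : ℤ)⟧) (m₃ : p⟦(1 : ℤ)⟧ ⟶ x⟦j⟧)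
      (n : x⟦j⟧ ⟶ (w⟦(1 : ℤ)⟧)⟦(1 : ℤ)⟧), Triangle.mk m₁ m₃ n ∈ distTriang C ∧ η ≫ m₃ = s.g :=
    ⟨o.m₁, o.m₃, _, o.mem, o.comm₃⟩
  obtain ⟨f', g', h', hs', hg'⟩ := exists_desuspension hm ((shiftFunctorAdd' C i 1 j hij).app x)
  refine ⟨⟨w, p, f', g', h', hs'⟩, k, η, rfl, hp, ?_⟩
  change η ≫ g'⟦(1 : ℤ)⟧' ≫ _ = _
  rw [hg', Category.assoc]
  have h2 : ((shiftFunctorAdd' C i 1 j hij).app x).hom ≫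
      (shiftFunctorAdd' C i 1 j hij).inv.app x = 𝟙 _ :=
    ((shiftFunctorAdd' C i 1 j hij).app x).hom_inv_id
  rw [h2, Category.comp_id, hη]

variable {S : ObjectProperty C} {d : ℕ}

/-- In a `d`-cluster tilting subcategory closed under `Σ^d`, every morphism `s ⟶ Σ^d s'`
is the last morphism of a `(d+2)`-angle. -/
lemma exists_angle [IsTriangulated C] (hS : IsClusterTilting d S) (hd : 1 ≤ d)
    {top bot : S.FullSubcategory} (γ : bot.obj ⟶ top.obj⟦(d : ℤ)⟧) :
    ∃ A : Angle S d top bot, A.γ = γ := by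
  have happ : ∀ w : C, ∃ (w' c : C) (a : w' ⟶ c) (b : c ⟶ w) (δ : w ⟶ w'⟦(1 : ℤ)⟧),
      Triangle.mk a b δ ∈ distTriang C ∧ S c ∧ (∀ s, S s → IsApprox s b) ∧
        (S w → IsZero w') := by
    intro w
    -- Taking the identity when `w` is already in `S` makes the resolution stop with syzygy exactly
    -- zero.
    by_cases hw : S w
    · exact ⟨_, w, _, _, _, contractible_distinguished₁ w, hw,
        fun s _ g => ⟨g, Category.comp_id _⟩, fun _ => isZero_zero C⟩
    · obtain ⟨c, hc, b, hb⟩ := hS.exists_right_approx w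
      obtain ⟨w', a, δ, h⟩ := distinguished_cocone_triangle₁ b
      exact ⟨w', c, a, b, δ, h, hc, fun s hs g => hb s hs g, fun h => absurd h hw⟩
  choose W P a b δ hP hSP hb hW using happ
  have hnext : ∀ (i : ℕ) (s : AngleState top.obj ((d : ℤ) - i)),
      ∃ (s' : AngleState top.obj ((d : ℤ) - (i + 1 : ℕ))) (α : s'.v ⟶ P s.w)
        (η : s.v ⟶ s'.v⟦(1 : ℤ)⟧), s'.w = W s.w ∧
        Triangle.mk α (b s.w ≫ s.f) η ∈ distTriang C ∧
        η ≫ s'.g⟦(1 : ℤ)⟧' ≫ (shiftFunctorAdd' C ((d : ℤ) - (i + 1 : ℕ)) 1 ((d : ℤ) - i)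
          (by push_cast; ring)).inv.app top.obj = s.g :=
    fun i s => s.exists_next (by push_cast; ring) (hP s.w)
  choose N α η hNw hNα hNη using hnext
  let e₀ : top.obj⟦(d : ℤ) - (0 : ℕ)⟧ ⟶ top.obj⟦(d : ℤ)⟧ :=
    (shiftFunctorZero' C ((0 : ℕ) : ℤ) rfl).inv.app _ ≫
      (shiftFunctorAdd' C ((d : ℤ) - (0 : ℕ)) ((0 : ℕ) : ℤ) d (by simp)).inv.app top.obj
  -- The tower comes from resolving the cocone `w₀` of `γ` by objects of `S`; `e₀` only identifies
  -- `d - 0` with `d`.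
  obtain ⟨w₀, f₀, h₀, hw₀⟩ := distinguished_cocone_triangle₁ (γ ≫ inv e₀)
  let σ : (i : ℕ) → AngleState top.obj ((d : ℤ) - i) :=
    fun i => Nat.rec ⟨w₀, bot.obj, f₀, γ ≫ inv e₀, h₀, hw₀⟩ N i
  have horth : ∀ i : ℕ, i + 1 ≤ d → ∀ s, S s → ∀ j : ℤ, 1 ≤ j → j ≤ i →
      Orth s (σ i).w j := by
    intro i
    induction i with
    | zero => intro _ s _ j h1 h2; omega
    | succ i ih =>
      intro hi s hs j h1 h2
      have hw : (σ (i + 1)).w = W (σ i).w := hNw i (σ i)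
      rw [hw]
      obtain rfl | h3 : j = 1 ∨ 1 ≤ j - 1 := by omega
      · exact (hb _ s hs).orth_one (hP _) (hS.orth hs (hSP _) le_rfl (by omega))
      · exact orth₁ (hP _) (sub_add_cancel j 1)
          (hS.orth hs (hSP _) h1 (by push_cast at h2; omega))
          (ih (by omega) s hs _ h3 (by push_cast at h2; omega))
  -- The syzygy at stage `d - 1` has vanishing in degrees `1, …, d - 1`, so it lies in `S` and the
  -- next one is zero.
  have hzero : IsZero (σ d).w := by
    obtain ⟨i, rfl⟩ : ∃ i, d = i + 1 := ⟨d - 1, by omega⟩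
    have hw : (σ (i + 1)).w = W (σ i).w := hNw i (σ i)
    rw [hw]
    exact hW _ ((hS.iff_ext_left _).2 fun s hs j h1 h2 =>
      horth i le_rfl s hs j (by omega) (by omega))
  have hiso : IsIso (σ d).g := (Triangle.isZero₁_iff_isIso₂ _ (σ d).mem).1 hzero
  let q : (σ d).v⟦(d : ℤ)⟧ ≅ top.obj⟦(d : ℤ)⟧ := asIso ((σ d).g⟦(d : ℤ)⟧' ≫
    (shiftFunctorAdd' C ((d : ℤ) - d) d d (by ring)).inv.app top.obj)
  let A : Angle S d top bot :=
    { c := fun i => P (σ i).w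
      v := fun i => (σ i).v
      α := fun i => α i (σ i)
      β := fun i => b (σ i).w ≫ (σ i).f
      δ := fun i => η i (σ i)
      distinguished := fun i _ => hNα i (σ i)
      mem := fun i _ => hSP _
      botIso := Iso.refl _
      topIso := (shiftFunctor C (d : ℤ)).preimageIso q }
  -- Invariant of the construction; at `i = d` the factor after `A.connecting d` is the isomorphism
  -- `q` defining `topIso`.
  have hconn : ∀ i : ℕ, A.connecting i ≫ (σ i).g⟦(i : ℤ)⟧' ≫
      (shiftFunctorAdd' C ((d : ℤ) - i) i d (by ring)).inv.app top.obj = γ := by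
    intro i
    induction i with
    | zero =>
      have h1 := (shiftFunctorZero' C ((0 : ℕ) : ℤ) rfl).inv.naturality (γ ≫ inv e₀)
      change _ ≫ _ = (shiftFunctorZero' C ((0 : ℕ) : ℤ) rfl).inv.app _ ≫
        (γ ≫ inv e₀)⟦((0 : ℕ) : ℤ)⟧' at h1
      change (shiftFunctorZero' C ((0 : ℕ) : ℤ) rfl).inv.app _ ≫
        (γ ≫ inv e₀)⟦((0 : ℕ) : ℤ)⟧' ≫ _ = γ
      rw [← Category.assoc, ← h1]
      change ((γ ≫ inv e₀) ≫ _) ≫ _ = γ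
      rw [Category.assoc]
      change (γ ≫ inv e₀) ≫ e₀ = γ
      simp
    | succ i ih =>
      rw [← ih, ← hNη i (σ i)]
      change (A.connecting i ≫ (η i (σ i))⟦(i : ℤ)⟧' ≫
        (shiftFunctorAdd' C (1 : ℤ) (i : ℤ) ((i + 1 : ℕ) : ℤ) _).inv.app _) ≫
        (N i (σ i)).g⟦((i + 1 : ℕ) : ℤ)⟧' ≫ _ = _
      have h1 := shiftFunctorAdd'_assoc_inv_app ((d : ℤ) - (i + 1 : ℕ)) 1 i ((d : ℤ) - i)
        ((i + 1 : ℕ) : ℤ) d (by push_cast; ring) (by push_cast; ring) (by push_cast; ring) top.obj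
      have h2 := (shiftFunctorAdd' C (1 : ℤ) (i : ℤ) ((i + 1 : ℕ) : ℤ)
        (by push_cast; ring)).inv.naturality (N i (σ i)).g
      simp only [Functor.map_comp, Category.assoc]
      rw [h1]
      congr 2
      rw [← Category.assoc, ← Category.assoc]
      congr 1
      exact h2.symm
  refine ⟨A, ?_⟩
  rw [Angle.γ, ← hconn d]
  change 𝟙 _ ≫ A.connecting d ≫ ((shiftFunctor C (d : ℤ)).preimageIso q).hom⟦(d : ℤ)⟧' = _
  rw [Category.id_comp]
  congr 1
  exact (shiftFunctor C (d : ℤ)).map_preimage _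

end AngleExistence

/-! ### Grothendieck groups of modules and simple modules. -/

section GrothendieckGroup

variable {R : Type v} [Ring R]

lemma K0Mod.cls_eq_add {M' M M'' : FGModuleCat.{v} R} (f : M' →ₗ[R] M) (g : M →ₗ[R] M'')
    (hf : Function.Injective f) (hfg : Function.Exact f g) (hg : Function.Surjective g) :
    K0Mod.cls M = K0Mod.cls M' + K0Mod.cls M'' := by
  have h : FreeAbelianGroup.of M - (FreeAbelianGroup.of M' + FreeAbelianGroup.of M'') ∈
      exactRelations R := AddSubgroup.subset_closure ⟨M', M, M'', f, g, hf, hfg, hg, rfl⟩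
  rw [← QuotientAddGroup.eq_zero_iff, QuotientAddGroup.mk_sub, QuotientAddGroup.mk_add,
    sub_eq_zero] at h
  exact h

lemma K0Mod.cls_eq_zero (M : FGModuleCat.{v} R) [Subsingleton M] : K0Mod.cls M = 0 := by
  have := K0Mod.cls_eq_add (M' := M) (M := M) (M'' := M) 0 0
    (Function.injective_of_subsingleton _) (fun x => ⟨fun _ => ⟨x, Subsingleton.elim _ _⟩,
      fun _ => Subsingleton.elim _ _⟩) fun x => ⟨x, Subsingleton.elim _ _⟩
  simpa using this

lemma K0Mod.cls_congr {M N : FGModuleCat.{v} R} (e : M ≃ₗ[R] N) :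
    K0Mod.cls M = K0Mod.cls N := by
  let Z : FGModuleCat.{v} R := FGModuleCat.of R PUnit.{v + 1}
  have : Subsingleton Z := inferInstanceAs (Subsingleton PUnit)
  have h := K0Mod.cls_eq_add (M' := Z) (M := M) (M'' := N) 0 e.toLinearMap
    (Function.injective_of_subsingleton _) (fun x => by
      constructor
      · intro hx
        exact ⟨0, (e.map_eq_zero_iff.1 hx).symm⟩
      · rintro ⟨y, rfl⟩
        exact map_zero e) e.surjective
  rw [h, K0Mod.cls_eq_zero, zero_add]

/-- Two homomorphisms from the Grothendieck group of an artinian ring agree if they agree on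
the classes of the simple modules. -/
lemma K0Mod.hom_ext_of_simple [IsArtinianRing R] {G : Type*} [AddCommGroup G]
    {θ θ' : K0Mod R →+ G}
    (h : ∀ M : FGModuleCat.{v} R, IsSimpleModule R M → θ (K0Mod.cls M) = θ' (K0Mod.cls M)) :
    θ = θ' := by
  have key : ∀ (M : Type v) [AddCommGroup M] [Module R M], IsFiniteLength R M →
      ∀ [Module.Finite R M],
        θ (K0Mod.cls (FGModuleCat.of R M)) = θ' (K0Mod.cls (FGModuleCat.of R M)) := by
    intro M _ _ hM
    induction hM with
    | @of_subsingleton M _ _ hs =>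
      intro _
      have : Subsingleton (FGModuleCat.of R M) := hs
      rw [K0Mod.cls_eq_zero, map_zero, map_zero]
    | @of_simple_quotient M _ _ N hs _ ih =>
      intro _
      have e := K0Mod.cls_eq_add (M' := FGModuleCat.of R N) (M := FGModuleCat.of R M)
        (M'' := FGModuleCat.of R (M ⧸ N)) N.subtype N.mkQ N.injective_subtype
        (LinearMap.exact_subtype_mkQ N) N.mkQ_surjective
      rw [e, map_add, map_add, ih, h _ hs]
  refine QuotientAddGroup.addMonoidHom_ext _ (FreeAbelianGroup.lift_ext _ _ fun M => ?_)
  exact key M (isFiniteLength_iff_isNoetherian_isArtinian.2 ⟨inferInstance, inferInstance⟩)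

end GrothendieckGroup

/-! ### Uniqueness of `θ` from Calabi–Yau duality. -/

section Uniqueness

variable {C : Type u} [Category.{v} C] [Preadditive C] [HasZeroObject C] [HasShift C ℤ]
  [∀ n : ℤ, (shiftFunctor C n).Additive] [Pretriangulated C]
  (k : Type w) [Field k] [Linear k C] [∀ X Y : C, Module.Finite k (X ⟶ Y)]
  {S : ObjectProperty C} {d : ℕ} {t : C}

omit [HasZeroObject C] [HasShift C ℤ] [∀ n : ℤ, (shiftFunctor C n).Additive]
  [Pretriangulated C] in
include k in
lemma isArtinianRing_end_op (t : C) : IsArtinianRing (End t)ᵐᵒᵖ := by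
  have : Module.Finite k (End t) := inferInstanceAs (Module.Finite k (t ⟶ t))
  have : Module.Finite k (End t)ᵐᵒᵖ := Module.Finite.equiv (MulOpposite.opLinearEquiv k)
  exact IsArtinianRing.of_finite k _

omit [Pretriangulated C] [HasZeroObject C] [∀ n : ℤ, (shiftFunctor C n).Additive] in
/-- A simple right module over `Γ = End t` is the image of `F γ` for some
`γ : t ⟶ (Σ^d)² t`. -/
lemma exists_range_equiv_of_simple (hCY : IsCalabiYau k S d) (htS : S t) (M : Type v)
    [AddCommGroup M] [Module (End t)ᵐᵒᵖ M] [IsSimpleModule (End t)ᵐᵒᵖ M] :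
    ∃ γ : t ⟶ (t⟦(d : ℤ)⟧)⟦(d : ℤ)⟧,
      Nonempty (LinearMap.range (mapF t γ) ≃ₗ[(End t)ᵐᵒᵖ] M) := by
  obtain ⟨e, he, -⟩ := hCY
  let T : S.FullSubcategory := ⟨t, htS⟩
  have : Nontrivial M := IsSimpleModule.nontrivial (End t)ᵐᵒᵖ M
  obtain ⟨x, hx⟩ := exists_ne (0 : M)
  let φ : (preadditiveCoyonedaObj t).obj t →ₗ[(End t)ᵐᵒᵖ] M :=
    { toFun := fun g => MulOpposite.op (show End t from g) • x
      map_add' := fun g g' => add_smul (MulOpposite.op (show End t from g))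
        (MulOpposite.op (show End t from g')) x
      map_smul' := fun r g => mul_smul r (MulOpposite.op (show End t from g)) x }
  let one : (preadditiveCoyonedaObj t).obj t := 𝟙 t
  have hφ1 : φ one = x := one_smul _ x
  have hφ : Function.Surjective φ := by
    refine (LinearMap.surjective_or_eq_zero φ).resolve_right fun h => hx ?_
    rw [← hφ1, h, LinearMap.zero_apply]
  -- A functional on `End t` that kills the maximal right ideal `ker φ` but not `1`; duality turns
  -- it into `γ`, with `e f γ = μ f`.
  obtain ⟨μ, hμ1, hμ⟩ := Submodule.exists_dual_map_eq_bot_of_notMem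
    (p := toSubspace k t t (LinearMap.ker φ)) (x := 𝟙 t) (fun h => hx (hφ1.symm.trans h))
    inferInstance
  have hμ0 : ∀ g : t ⟶ t, φ g = 0 → μ g = 0 := fun g hg => by
    have : μ g ∈ (toSubspace k t t (LinearMap.ker φ)).map μ := ⟨g, hg, rfl⟩
    rwa [hμ, Submodule.mem_bot] at this
  let γ : t ⟶ (t⟦(d : ℤ)⟧)⟦(d : ℤ)⟧ := (Module.evalEquiv k _).symm (μ ∘ₗ (e T T).symm.toLinearMap)
  have hγ : ∀ f : t ⟶ t, e T T f γ = μ f := fun f => by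
    change e T T f ((Module.evalEquiv k _).symm (μ ∘ₗ (e T T).symm.toLinearMap)) = μ f
    rw [Module.apply_evalEquiv_symm_apply]
    exact congrArg μ ((e T T).symm_apply_apply f)
  -- By naturality `g ≫ γ` pairs with `f` to `μ (f ≫ g)`, and `f ≫ g` stays in the right ideal `ker
  -- φ`.
  have hle : ∀ g : t ⟶ t, φ g = 0 → g ≫ γ = 0 := fun g hg => by
    rw [← Module.forall_dual_apply_eq_zero_iff k]
    intro l
    obtain ⟨f, rfl⟩ := (e T T).surjective l
    rw [← he T T T f g γ]
    refine (hγ (f ≫ g)).trans (hμ0 _ ?_)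
    have := φ.map_smul (MulOpposite.op (show End t from f)) g
    rw [hg, smul_zero] at this
    exact this
  refine ⟨γ, nonempty_equiv_of_ker_eq (mapF t γ).surjective_rangeRestrict hφ ?_⟩
  rw [LinearMap.ker_rangeRestrict]
  refine le_antisymm (fun g hg => ?_) fun g hg => hle g hg
  by_contra hne
  -- Otherwise `φ g` generates `M`, so some `r • g - 1` lies in `ker φ`; both `g` and it annihilate
  -- `γ`, giving `γ = 0` against `μ 1 ≠ 0`.
  obtain ⟨r, hr⟩ := IsSimpleModule.toSpanSingleton_surjective (End t)ᵐᵒᵖ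
    (m := φ g) (fun h => hne h) x
  have h1 : φ (r • g - one) = 0 := by
    rw [map_sub, map_smul, hφ1, sub_eq_zero]
    exact hr
  have h2 : mapF t γ (r • g - one) = 0 := hle _ h1
  rw [map_sub, map_smul, show mapF t γ g = 0 from hg, smul_zero, zero_sub, neg_eq_zero] at h2
  have h3 : γ = 0 := (Category.id_comp γ).symm.trans h2
  apply hμ1
  rw [← hγ, h3, map_zero]

/-- A simple module is `Im F γ` for some `γ : t ⟶ Σ^d (Σ^d t)`, and an angle ending in `γ`
prescribes the value of `θ` there. -/
lemma IsTheta.unique [IsTriangulated C] (hS : IsClusterTilting d S) (hd : 1 ≤ d)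
    (hSshift : ∀ x : C, S x ↔ S (x⟦(d : ℤ)⟧)) (htS : S t) (hCY : IsCalabiYau k S d)
    {θ θ' : K0Mod (End t)ᵐᵒᵖ →+ K0Split (addClosure t)} (hθ : IsTheta k S d t θ)
    (hθ' : IsTheta k S d t θ') : θ = θ' := by
  have := isArtinianRing_end_op k t
  refine K0Mod.hom_ext_of_simple fun M hM => ?_
  obtain ⟨γ, ⟨e⟩⟩ := exists_range_equiv_of_simple k hCY htS M
  obtain ⟨A, rfl⟩ := exists_angle hS hd (top := ⟨t⟦(d : ℤ)⟧, (hSshift t).1 htS⟩)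
    (bot := ⟨t, htS⟩) γ
  have h : K0Mod.cls M = K0Mod.cls (imageF k t A.γ) := (K0Mod.cls_congr e).symm
  rw [h, ← hθ, ← hθ']

end Uniqueness

/-! ### The exchange relation. -/

section Frieze

variable {C : Type u} [Category.{v} C] [Preadditive C] [HasZeroObject C] [HasShift C ℤ]
  [∀ n : ℤ, (shiftFunctor C n).Additive] [Pretriangulated C]
  (k : Type w) [Field k] [Linear k C] [∀ n : ℤ, (shiftFunctor C n).Linear k]
  [∀ X Y : C, Module.Finite k (X ⟶ Y)]
  {S : ObjectProperty C} {d : ℕ} {t : C}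

omit [Pretriangulated C] [HasZeroObject C] in
/-- For an exchange pair, one of the two exchange morphisms is killed by `C(t, -)`. -/
lemma killedBy_or_killedBy (hSshift : ∀ x : C, S x ↔ S (x⟦(d : ℤ)⟧)) (htS : S t)
    (htd : Orth t t d) (hCY : IsCalabiYau k S d) {s₀ s₁ : S.FullSubcategory}
    (hdim : Module.finrank k (s₀.obj ⟶ s₁.obj⟦(d : ℤ)⟧) = 1)
    (γ : s₀.obj ⟶ s₁.obj⟦(d : ℤ)⟧) (γ' : s₁.obj ⟶ s₀.obj⟦(d : ℤ)⟧) :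
    KilledBy t γ ∨ KilledBy t γ' := by
  by_contra! hcon
  obtain ⟨h1, h2⟩ := hcon
  obtain ⟨h, hh⟩ : ∃ h : t ⟶ s₀.obj, h ≫ γ ≠ 0 := by
    simpa [KilledBy] using h1
  apply h2
  obtain ⟨e, -, he⟩ := hCY
  let T : S.FullSubcategory := ⟨t, htS⟩
  let Y : S.FullSubcategory := ⟨s₁.obj⟦(d : ℤ)⟧, (hSshift _).1 s₁.property⟩
  -- Nondegeneracy of the duality pairing detects `h ≫ γ ≠ 0`; naturality then moves `h` to the
  -- other side, giving a nonzero morphism `s₁ ⟶ Σ^d t ⟶ Σ^d s₀`.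
  obtain ⟨u, hu⟩ : ∃ u : Y.obj ⟶ (t⟦(d : ℤ)⟧)⟦(d : ℤ)⟧, e T Y (h ≫ γ) u ≠ 0 := by
    by_contra! hz
    exact hh ((e T Y).map_eq_zero_iff.1 (LinearMap.ext hz))
  rw [he s₀ T Y h γ u] at hu
  obtain ⟨u', rfl⟩ := (shiftFunctor C (d : ℤ)).map_surjective u
  have hne : u' ≫ h⟦(d : ℤ)⟧' ≠ 0 := fun hz => hu (by
    rw [← Functor.map_comp, hz, Functor.map_zero, map_zero])
  let L : (s₁.obj ⟶ s₀.obj⟦(d : ℤ)⟧) →ₗ[k]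
      (s₁.obj⟦(d : ℤ)⟧ ⟶ (s₀.obj⟦(d : ℤ)⟧)⟦(d : ℤ)⟧) := (shiftFunctor C (d : ℤ)).mapLinearMap k
  have hL : Function.Injective L := (shiftFunctor C (d : ℤ)).map_injective
  have hdim' : Module.finrank k (s₁.obj ⟶ s₀.obj⟦(d : ℤ)⟧) ≤ 1 := by
    refine (LinearMap.finrank_le_finrank_of_injective hL).trans ?_
    rw [← Subspace.dual_finrank_eq, ← hdim]
    exact (e s₀ Y).finrank_eq.symm.le
  -- By duality `C(s₁, Σ^d s₀)` is also one-dimensional, so `γ'` factors through `Σ^d t` and is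
  -- killed because `C(t, Σ^d t) = 0`.
  obtain ⟨c, rfl⟩ : ∃ c : k, c • (u' ≫ h⟦(d : ℤ)⟧') = γ' := by
    have h1 : Module.finrank k (s₁.obj ⟶ s₀.obj⟦(d : ℤ)⟧) = 1 :=
      le_antisymm hdim' (Module.finrank_pos_iff_exists_ne_zero.2 ⟨_, hne⟩)
    exact (finrank_eq_one_iff_of_nonzero' _ hne).1 h1 γ'
  intro g
  have : g ≫ u' ≫ h⟦(d : ℤ)⟧' = 0 := by
    rw [← Category.assoc, htd (g ≫ u'), zero_comp]
  rw [Linear.comp_smul, this, smul_zero]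

omit [HasZeroObject C] [HasShift C ℤ] [∀ n : ℤ, (shiftFunctor C n).Additive]
  [Pretriangulated C] [∀ n : ℤ, (shiftFunctor C n).Linear k] in
lemma cls_imageF_eq_zero {X Y : C} {γ : X ⟶ Y} (h : KilledBy t γ) :
    K0Mod.cls (imageF k t γ) = 0 := by
  have : Subsingleton (imageF k t γ) := by
    refine ⟨?_⟩
    rintro ⟨_, x, rfl⟩ ⟨_, y, rfl⟩
    exact Subtype.ext ((h x).trans (h y).symm)
  exact K0Mod.cls_eq_zero _

/-- For odd `d` both angles give the same left hand side. Subtracting the middle sum of either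
leaves a value of `φθ`, which is nonnegative, and is zero for the angle whose last morphism is
killed by `F`. -/
lemma isTropicalFrieze [IsTriangulated C] [IsIdempotentComplete C] (hd : Odd d)
    (hS : IsClusterTilting d S) (hSshift : ∀ x : C, S x ↔ S (x⟦(d : ℤ)⟧)) (htS : S t)
    (hT : IsClusterTilting (2 * d) (addClosure t)) (hCY : IsCalabiYau k S d)
    {θ : K0Mod (End t)ᵐᵒᵖ →+ K0Split (addClosure t)} (hθ : IsTheta k S d t θ)
    (φ : K0Split (addClosure t) →+ ℤ)
    (hφ : ∀ M : FGModuleCat.{v} (End t)ᵐᵒᵖ, 0 ≤ φ (θ (K0Mod.cls M))) :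
    IsTropicalFrieze k S d (fun s => φ (index S d t s)) := by
  have hd1 : 1 ≤ d := hd.pos
  obtain ⟨ind, H⟩ := hT.exists_isTriangulatedIndex (by omega)
  have hidx := index_eq k hS hd1 htS hT H
  refine ⟨fun a b ⟨e⟩ => ?_, fun a b c ⟨e⟩ => ?_, ?_⟩
  · simp only [hidx]
    exact congrArg φ (H.iso (S.ι.mapIso e))
  · simp only [hidx]
    rw [H.biprod e, map_add]
  · intro s₀ s₁ hex A B _ _
    have hsign : (-1 : ℤ) ^ (d + 1) = 1 := hd.add_one.neg_one_pow
    have hA := congrArg φ (hθ s₁ s₀ A)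
    have hB := congrArg φ (hθ s₀ s₁ B)
    -- Reversal preserves parity since `d - 1` is even.
    have hrev : ∀ i : Fin d, (-1 : ℤ) ^ ((i.rev : ℕ)) = (-1) ^ (i : ℕ) := fun i => by
      obtain ⟨r, hr⟩ := hd
      have : (i.rev : ℕ) + i + i = d - 1 + i := by
        rw [Fin.val_rev]; omega
      have h2 : (-1 : ℤ) ^ ((i.rev : ℕ) + i + i) = (-1) ^ (i.rev : ℕ) := by
        rw [add_assoc, pow_add, ← two_mul, pow_mul]; simp
      rw [← h2, this, pow_add, show d - 1 = 2 * r by omega, pow_mul]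
      simp
    have hBsum : ∑ i : Fin d, (-1 : ℤ) ^ (i : ℕ) * φ (index S d t (B.obj i.rev)) =
        ∑ i : Fin d, (-1 : ℤ) ^ (i : ℕ) * φ (index S d t (B.obj i)) := by
      rw [← Equiv.sum_comp Fin.revPerm]
      exact Finset.sum_congr rfl fun i _ => by
        rw [Fin.revPerm_apply, Fin.rev_rev, hrev]
    simp only [map_add, map_sum, map_zsmul, hsign, one_smul, smul_eq_mul, pow_succ, mul_neg_one,
      neg_mul, Finset.sum_neg_distrib] at hA hB
    have pA := hφ (imageF k t A.γ)
    have pB := hφ (imageF k t B.γ)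
    have hor := killedBy_or_killedBy k hSshift htS
      (hT.orth (addClosure_self t) (addClosure_self t) (by omega) (by push_cast; omega)) hCY
      hex.finrank_eq_one A.γ B.γ
    simp only [hsign, one_mul]
    rw [hBsum]
    obtain h | h := hor
    · rw [cls_imageF_eq_zero k h, map_zero, map_zero] at hA
      rw [max_eq_left] <;> linarith
    · rw [cls_imageF_eq_zero k h, map_zero, map_zero] at hB
      rw [max_eq_right] <;> linarith

end Frieze

end HigherFrieze

theorem theoremB (k : Type w) [Field k] {C : Type u} [Category.{v} C] [Preadditive C]
    [Linear k C] [HasZeroObject C] [HasShift C ℤ] [∀ n : ℤ, (shiftFunctor C n).Additive]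
    [∀ n : ℤ, (shiftFunctor C n).Linear k] [Pretriangulated C] [IsTriangulated C]
    [IsIdempotentComplete C] [∀ X Y : C, Module.Finite k (X ⟶ Y)]
    (d : ℕ) (hd : Odd d)
    (S : ObjectProperty C) (hS : IsClusterTilting d S)
    (hSshift : ∀ x : C, S x ↔ S (x⟦(d : ℤ)⟧))
    (t : C) (htS : S t) (ht : IsClusterTilting (2 * d) (addClosure t))
    (hCY : IsCalabiYau k S d) :
    (∀ s : S.FullSubcategory, ∃! x, IsIndex S d t s x) ∧
    (∃! θ, IsTheta k S d t θ) ∧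
    ∀ φ : K0Split (addClosure t) →+ ℤ,
      (∀ M : FGModuleCat.{v} (End t)ᵐᵒᵖ, 0 ≤ φ (theta k S d t (K0Mod.cls M))) →
      IsTropicalFrieze k S d (fun s => φ (index S d t s)) := by
  have hθ := exists_isTheta k hS hd.pos htS ht
  refine ⟨exists_unique_isIndex k hS hd.pos htS ht, ?_, fun φ hφ => ?_⟩
  · obtain ⟨θ, h⟩ := hθ
    exact ⟨θ, h, fun θ' h' => h'.unique k hS hd.pos hSshift htS hCY h⟩
  · refine isTropicalFrieze k hd hS hSshift htS ht hCY ?_ φ hφ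
    rw [theta, dif_pos hθ]
    exact hθ.choose_spec
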